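/- Let $\mathcal V$ be a $3$-dimensional complex vector space, and fix a basis $b_0,b_1,b_2$ of $\mathcal V$ (indices modulo $3$). Let $\mathrm{Sym}^2\mathcal V\subset\mathcal V\otimes\mathcal V$ be the space of symmetric tensors, let $R=\mathbb C[\mathrm{Sym}^2\mathcal V]$, let $\gamma\colon R\otimes\mathcal V^\vee\to R\otimes\mathcal V$ be the tautological map $1\otimes\varphi\mapsto(\alpha\mapsto\alpha(\varphi))$, let $M$ be its (symmetric) matrix in the given basis and its dual basis, $M^c$ the matrix of cofactors of $M$, and $N=\operatorname{coker}\gamma$. Let $\xi_k\in N$ be the class of $1\otimes b_k$. The $R$-module $R/(\det M)\oplus N$ is a commutative ring with the product $(r,n)(r',n')=(rr'+m(n,n'),\,rn'+r'n)$, where $m\colon N\times N\to R/(\det M)$ is the $R$-bilinear map with $m(\xi_i,\xi_j)=M^c_{ij}$. Put $X(\mathcal V)=\operatorname{Spec}(R/(\det M)\oplus N)$ and $Y(\mathcal V)=\operatorname{Spec}(R/(\det M))$, let $f\colon X(\mathcal V)\to Y(\mathcal V)$ be the structure map, and let $\phi$ be the covering involution, given by $(r,n)\mapsto(r,-n)$.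 Let $(\mathcal V\otimes\mathcal V)_1=\{\mu\in\mathcal V\otimes\mathcal V\mid \operatorname{rk}\mu\le 1\}$, with its reduced structure, and let $\sigma\colon(\mathcal V\otimes\mathcal V)_1\to Y(\mathcal V)$, $\sigma(\mu)=\mu+\mu^t$. Then: 1. $Y(\mathcal V)$ is the reduced variety $\{\alpha\in\mathrm{Sym}^2\mathcal V\mid\operatorname{rk}\alpha<3\}$; that is, the ideal of regular functions vanishing on this set is $(\det M)$. 2. There is an isomorphism of $\mathbb C$-schemes $\tau\colon(\mathcal V\otimes\mathcal V)_1\to X(\mathcal V)$ such that $f\circ\tau=\sigma$ and $\phi\circ\tau=\tau\circ(\,\cdot\,)^t$, i.e. $\phi(\tau(\mu))=\tau(\mu^t)$. It can be chosen to be $\mu\mapsto(\mu+\mu^t,\ \sqrt{-1}\,(\mu-\mu^t))$, where $\mu-\mu^t\in\bigwedge^2\mathcal V\cong\mathcal V^\vee\otimes\bigwedge^3\mathcal V\cong\mathcal V^\vee$; explicitly $\tau^*\xi_k=\sqrt{-1}\,(\mu_{k+1,k+2}-\mu_{k+2,k+1})$, where $\mu=\sum\mu_{ij}\,b_i\otimes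 b_j$. 3. With this $\tau$, the singular locus of $X(\mathcal V)$ is the single point $\tau(0)$, and as a set it equals $f^{-1}(0)$. -/

import Mathlib

open TensorProduct Module AlgebraicGeometry CategoryTheory

noncomputable section

/-! ### The double cover attached to a symmetric map of free modules of rank 3 -/

/-- A homomorphism `map : U₁ → U₀` of free modules of rank `3`, with bases in which its matrix is
symmetric. (A symmetric map `γ : U^∨ → U` gives such data for any basis of `U` and the dual basis
of `U^∨`.) -/
structure SymmPresentation (R U₁ U₀ : Type*) [CommRing R] [AddCommGroup U₁] [Module R U₁]
    [AddCommGroup U₀] [Module R U₀] where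
  srcBasis : Basis (Fin 3) R U₁
  tgtBasis : Basis (Fin 3) R U₀
  map : U₁ →ₗ[R] U₀
  isSymm : (LinearMap.toMatrix srcBasis tgtBasis map).IsSymm

namespace SymmPresentation

variable {R U₁ U₀ : Type*} [CommRing R] [AddCommGroup U₁] [Module R U₁]
  [AddCommGroup U₀] [Module R U₀] (S : SymmPresentation R U₁ U₀)

/-- The matrix `M` of the map. -/
def mat : Matrix (Fin 3) (Fin 3) R := LinearMap.toMatrix S.srcBasis S.tgtBasis S.map

/-- The ideal `(det M)`, which is the Fitting ideal of the cokernel. -/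
def fitt : Ideal R := Ideal.span {S.mat.det}

/-- The cokernel `N` of the map. -/
def N : Type _ := U₀ ⧸ LinearMap.range S.map

instance : AddCommGroup S.N := inferInstanceAs (AddCommGroup (U₀ ⧸ LinearMap.range S.map))
instance : Module R S.N := inferInstanceAs (Module R (U₀ ⧸ LinearMap.range S.map))

/-- The projection `U₀ → N`. -/
def proj : U₀ →ₗ[R] S.N := (LinearMap.range S.map).mkQ

lemma proj_surjective : Function.Surjective S.proj := Submodule.mkQ_surjective _

lemma proj_map (y : U₁) : S.proj (S.map y) = 0 :=
  (Submodule.Quotient.mk_eq_zero _).2 ⟨y, rfl⟩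

lemma mat_isSymm : S.mat.transpose = S.mat := S.isSymm

lemma repr_map (y : U₁) : ⇑(S.tgtBasis.repr (S.map y)) = S.mat.mulVec (S.srcBasis.repr y) :=
  (LinearMap.toMatrix_mulVec_repr S.srcBasis S.tgtBasis S.map y).symm

lemma proj_eq_zero (u : U₀) (z : Fin 3 → R) (h : ⇑(S.tgtBasis.repr u) = S.mat.mulVec z) :
    S.proj u = 0 := by
  have : u = S.map (S.srcBasis.equivFun.symm z) := by
    apply S.tgtBasis.repr.injective
    ext i
    rw [S.repr_map, h]
    congr 1
    have := S.srcBasis.equivFun.apply_symm_apply z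
    rw [Basis.equivFun_apply] at this
    rw [this]
  rw [this, S.proj_map]

/-- The form `(u, u') ↦ u^T M^c u'` on `U₀`, where `M^c` is the (symmetric) matrix of cofactors. -/
def cofactorForm : U₀ →ₗ[R] U₀ →ₗ[R] R :=
  Matrix.toLinearMap₂ S.tgtBasis S.tgtBasis S.mat.adjugate

lemma cofactorForm_apply (u v : U₀) : S.cofactorForm u v =
    S.tgtBasis.repr u ⬝ᵥ S.mat.adjugate.mulVec (S.tgtBasis.repr v) := by
  simp only [cofactorForm, Matrix.toLinearMap₂_apply, dotProduct, Matrix.mulVec, Finset.mul_sum,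
    smul_eq_mul]
  exact Finset.sum_congr rfl fun i _ => Finset.sum_congr rfl fun j _ => by ring

lemma cofactorForm_comm (u v : U₀) : S.cofactorForm u v = S.cofactorForm v u := by
  have h : S.mat.adjugate.transpose = S.mat.adjugate := by
    rw [Matrix.adjugate_transpose, S.mat_isSymm]
  rw [cofactorForm_apply, cofactorForm_apply, Matrix.dotProduct_mulVec, dotProduct_comm,
    ← Matrix.mulVec_transpose, h]

lemma cofactorForm_map (u : U₀) (y : U₁) : S.cofactorForm u (S.map y) ∈ S.fitt := by
  rw [cofactorForm_apply, repr_map, Matrix.mulVec_mulVec, Matrix.adjugate_mul,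
    Matrix.smul_mulVec, dotProduct_smul, smul_eq_mul]
  exact Ideal.mul_mem_right _ _ (Ideal.subset_span rfl)

/-- The form on `U₀` modulo `det M`. -/
def cofactorFormMod : U₀ →ₗ[R] U₀ →ₗ[R] R ⧸ S.fitt :=
  S.cofactorForm.compr₂ (Submodule.mkQ S.fitt)

lemma cofactorFormMod_map (u : U₀) (y : U₁) : S.cofactorFormMod u (S.map y) = 0 :=
  Ideal.Quotient.eq_zero_iff_mem.2 (S.cofactorForm_map u y)

lemma cofactorFormMod_comm (u v : U₀) : S.cofactorFormMod u v = S.cofactorFormMod v u :=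
  congrArg (Submodule.mkQ S.fitt) (S.cofactorForm_comm u v)

/-- The multiplication `N × N → R/(det M)` with `(a_i, a_j) ↦ M^c_{ij}` on the classes of the
basis vectors. -/
def pairing : S.N →ₗ[R] S.N →ₗ[R] R ⧸ S.fitt :=
  (LinearMap.range S.map).liftQ
    (((LinearMap.range S.map).liftQ S.cofactorFormMod (by
      rintro _ ⟨y, rfl⟩
      ext u
      rw [S.cofactorFormMod_comm, S.cofactorFormMod_map, LinearMap.zero_apply])).flip) (by
      rintro _ ⟨y, rfl⟩
      refine LinearMap.ext fun n => ?_
      obtain ⟨u, rfl⟩ := Submodule.mkQ_surjective _ n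
      exact S.cofactorFormMod_map u y)

lemma pairing_proj (u v : U₀) :
    S.pairing (S.proj u) (S.proj v) = Ideal.Quotient.mk S.fitt (S.cofactorForm u v) :=
  S.cofactorFormMod_comm v u

/-- The multiplication is the one induced by the extension class: a lift `y ∈ U₁ = U₀^∨` of
`m(u, ·)` is determined by `γ(y) = (det M) u`. -/
lemma pairing_proj_of_map_eq (hdet : S.mat.det ∈ nonZeroDivisors R) (u v : U₀) (y : U₁)
    (h : S.map y = S.mat.det • u) : S.pairing (S.proj u) (S.proj v) =
      Ideal.Quotient.mk S.fitt (S.srcBasis.repr y ⬝ᵥ S.tgtBasis.repr v) := by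
  have h1 : S.mat.mulVec (S.srcBasis.repr y) = S.mat.det • ⇑(S.tgtBasis.repr u) := by
    rw [← repr_map, h, map_smul]; rfl
  have h2 := congrArg S.mat.adjugate.mulVec h1
  rw [Matrix.mulVec_mulVec, Matrix.adjugate_mul, Matrix.smul_mulVec, Matrix.one_mulVec,
    Matrix.mulVec_smul] at h2
  have h3 : ⇑(S.srcBasis.repr y) = S.mat.adjugate.mulVec (S.tgtBasis.repr u) := by
    funext i
    have := congrFun h2 i
    simp only [Pi.smul_apply, smul_eq_mul] at this
    exact (mul_cancel_left_mem_nonZeroDivisors hdet).1 this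
  rw [pairing_proj, cofactorForm_comm, cofactorForm_apply, h3, dotProduct_comm]

lemma pairing_comm (n n' : S.N) : S.pairing n n' = S.pairing n' n := by
  obtain ⟨u, rfl⟩ := S.proj_surjective n
  obtain ⟨v, rfl⟩ := S.proj_surjective n'
  rw [pairing_proj, pairing_proj, cofactorForm_comm]

lemma isTorsion : IsTorsionBySet R S.N S.fitt := by
  intro n ⟨r, hr⟩
  obtain ⟨c, rfl⟩ := Ideal.mem_span_singleton'.1 hr
  obtain ⟨u, rfl⟩ := S.proj_surjective n
  change (c * S.mat.det) • S.proj u = 0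
  rw [← map_smul]
  refine S.proj_eq_zero _ (c • S.mat.adjugate.mulVec (S.tgtBasis.repr u)) ?_
  rw [Matrix.mulVec_smul, Matrix.mulVec_mulVec, Matrix.mul_adjugate, Matrix.smul_mulVec,
    Matrix.one_mulVec, smul_smul, map_smul]
  rfl

/-- `N` is a module over `R/(det M)`. -/
instance : Module (R ⧸ S.fitt) S.N := S.isTorsion.module

lemma mk_smul (r : R) (n : S.N) : Ideal.Quotient.mk S.fitt r • n = r • n := rfl

lemma pairing_smul (r : R ⧸ S.fitt) (n n' : S.N) :
    S.pairing n (r • n') = r * S.pairing n n' := by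
  obtain ⟨r, rfl⟩ := Ideal.Quotient.mk_surjective r
  rw [mk_smul, map_smul]
  rfl

lemma pairing_smul_left (r : R ⧸ S.fitt) (n n' : S.N) :
    S.pairing (r • n) n' = r * S.pairing n n' := by
  rw [pairing_comm, pairing_smul, pairing_comm]

lemma pairing_assoc (n n' n'' : S.N) :
    S.pairing n n' • n'' = S.pairing n' n'' • n := by
  obtain ⟨u, rfl⟩ := S.proj_surjective n
  obtain ⟨v, rfl⟩ := S.proj_surjective n'
  obtain ⟨w, rfl⟩ := S.proj_surjective n''
  rw [pairing_proj, pairing_proj, mk_smul, mk_smul, ← map_smul, ← map_smul, ← sub_eq_zero,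
    ← map_sub]
  have hs : ∀ i j, S.mat i j = S.mat j i := fun i j => congrFun (congrFun S.mat_isSymm j) i
  set a := S.tgtBasis.repr u with ha
  set c := S.tgtBasis.repr v with hc
  set d := S.tgtBasis.repr w with hd
  refine S.proj_eq_zero _ (crossProduct (S.mat.mulVec (crossProduct a d)) c) ?_
  have hM : S.mat.adjugate = !![S.mat 1 1 * S.mat 2 2 - S.mat 1 2 * S.mat 2 1,
      -(S.mat 0 1 * S.mat 2 2) + S.mat 0 2 * S.mat 2 1,
      S.mat 0 1 * S.mat 1 2 - S.mat 0 2 * S.mat 1 1;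
      -(S.mat 1 0 * S.mat 2 2) + S.mat 1 2 * S.mat 2 0,
      S.mat 0 0 * S.mat 2 2 - S.mat 0 2 * S.mat 2 0,
      -(S.mat 0 0 * S.mat 1 2) + S.mat 0 2 * S.mat 1 0;
      S.mat 1 0 * S.mat 2 1 - S.mat 1 1 * S.mat 2 0,
      -(S.mat 0 0 * S.mat 2 1) + S.mat 0 1 * S.mat 2 0,
      S.mat 0 0 * S.mat 1 1 - S.mat 0 1 * S.mat 1 0] := Matrix.adjugate_fin_three _
  funext i
  rw [map_sub, map_smul, map_smul, Finsupp.sub_apply, Finsupp.smul_apply, Finsupp.smul_apply,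
    cofactorForm_apply, cofactorForm_apply, ← ha, ← hc, ← hd, hM]
  have h10 := hs 1 0
  have h20 := hs 2 0
  have h21 := hs 2 1
  fin_cases i <;>
  simp [crossProduct, Matrix.mulVec, dotProduct, Fin.sum_univ_three, h10, h20, h21] <;> ring

/-- The coordinate ring `R/(det M) ⊕ N` of the double cover. -/
@[ext]
structure CoverRing where
  fst : R ⧸ S.fitt
  snd : S.N

namespace CoverRing

/-- `R/(det M) ⊕ N` as a direct sum. -/
def toProd : S.CoverRing ≃ (R ⧸ S.fitt) × S.N where
  toFun x := (x.fst, x.snd)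
  invFun x := ⟨x.1, x.2⟩

instance : AddCommGroup S.CoverRing := (toProd S).addCommGroup

/-- `(r, n) (r', n') = (r r' + m(n, n'), r n' + r' n)`. -/
instance : Mul S.CoverRing :=
  ⟨fun x y => ⟨x.1 * y.1 + S.pairing x.2 y.2, x.1 • y.2 + y.1 • x.2⟩⟩

instance : One S.CoverRing := ⟨⟨1, 0⟩⟩

variable {S}

lemma fst_mul (x y : S.CoverRing) : (x * y).1 = x.1 * y.1 + S.pairing x.2 y.2 := rfl
lemma snd_mul (x y : S.CoverRing) : (x * y).2 = x.1 • y.2 + y.1 • x.2 := rfl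
lemma fst_add (x y : S.CoverRing) : (x + y).1 = x.1 + y.1 := rfl
lemma snd_add (x y : S.CoverRing) : (x + y).2 = x.2 + y.2 := rfl
lemma fst_one : (1 : S.CoverRing).1 = 1 := rfl
lemma snd_one : (1 : S.CoverRing).2 = 0 := rfl
lemma fst_zero : (0 : S.CoverRing).1 = 0 := rfl
lemma snd_zero : (0 : S.CoverRing).2 = 0 := rfl

lemma mul_comm' (x y : S.CoverRing) : x * y = y * x := by
  ext
  · rw [fst_mul, fst_mul, mul_comm, pairing_comm]
  · rw [snd_mul, snd_mul, add_comm]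

lemma left_distrib' (x y z : S.CoverRing) : x * (y + z) = x * y + x * z := by
  ext
  · simp only [fst_mul, fst_add, snd_add, map_add]; ring
  · simp only [snd_mul, fst_add, snd_add, smul_add, add_smul]; abel

lemma one_mul' (x : S.CoverRing) : 1 * x = x := by
  ext
  · simp only [fst_mul, fst_one, snd_one, map_zero, LinearMap.zero_apply, one_mul, add_zero]
  · simp only [snd_mul, fst_one, snd_one, one_smul, smul_zero, add_zero]

lemma zero_mul' (x : S.CoverRing) : 0 * x = 0 := by
  ext
  · simp only [fst_mul, fst_zero, snd_zero, map_zero, LinearMap.zero_apply, zero_mul, add_zero]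
  · simp only [snd_mul, fst_zero, snd_zero, zero_smul, smul_zero, add_zero]

lemma mul_assoc' (x y z : S.CoverRing) : x * y * z = x * (y * z) := by
  ext
  · simp only [fst_mul, snd_mul, map_add, LinearMap.add_apply, pairing_smul, pairing_smul_left]
    ring
  · simp only [fst_mul, snd_mul, add_smul, smul_add, smul_smul]
    rw [S.pairing_assoc x.2 y.2 z.2, mul_comm z.1 x.1, mul_comm z.1 y.1]
    abel

instance : CommRing S.CoverRing where
  __ := (inferInstance : AddCommGroup S.CoverRing)
  mul_assoc := mul_assoc'
  one_mul := one_mul'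
  mul_one x := by rw [mul_comm', one_mul']
  left_distrib := left_distrib'
  right_distrib x y z := by rw [mul_comm', left_distrib', mul_comm' z, mul_comm' z]
  zero_mul := zero_mul'
  mul_zero x := by rw [mul_comm', zero_mul']
  mul_comm := mul_comm'

variable (S)

/-- The structure map `R/(det M) → R/(det M) ⊕ N`. -/
def structureHom : (R ⧸ S.fitt) →+* S.CoverRing where
  toFun r := ⟨r, 0⟩
  map_one' := rfl
  map_zero' := rfl
  map_add' r s := by
    ext
    · rfl
    · simp [snd_add]
  map_mul' r s := by
    ext
    · simp [fst_mul]
    · simp [snd_mul]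

instance [Algebra ℂ R] : Algebra ℂ S.CoverRing :=
  ((structureHom S).comp ((Ideal.Quotient.mk S.fitt).comp (algebraMap ℂ R))).toAlgebra

/-- The inclusion of `N`. -/
def ofN (n : S.N) : S.CoverRing := ⟨0, n⟩

/-- The involution `(r, n) ↦ (r, -n)`. -/
def involution : S.CoverRing →+* S.CoverRing where
  toFun x := ⟨x.1, -x.2⟩
  map_one' := by ext <;> simp [fst_one, snd_one]
  map_zero' := by ext <;> simp [fst_zero, snd_zero]
  map_add' x y := by
    ext
    · rfl
    · simp [snd_add, add_comm]
  map_mul' x y := by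
    ext
    · simp [fst_mul]
    · simp [snd_mul, add_comm]

end CoverRing

end SymmPresentation

/-! ### Regular functions on a vector space -/

section Regular

variable (W : Type*) [AddCommGroup W] [Module ℂ W]

/-- The ring `ℂ[W]` of regular functions on a finite-dimensional space `W`. -/
abbrev Reg : Type _ := SymmetricAlgebra ℂ (Dual ℂ W)

variable {W}

/-- Evaluation of regular functions at a point. -/
def evalAt (w : W) : Reg W →ₐ[ℂ] ℂ := SymmetricAlgebra.lift (Dual.eval ℂ W w)

/-- The ideal of regular functions that vanish on a set. -/
def idealOf (Z : Set W) : Ideal (Reg W) := ⨅ w ∈ Z, RingHom.ker (evalAt w)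

lemma mem_idealOf {Z : Set W} {p : Reg W} : p ∈ idealOf Z ↔ ∀ w ∈ Z, evalAt w p = 0 := by
  simp [idealOf, RingHom.mem_ker]

/-- Pull-back of regular functions along a linear map. -/
def pullback {W' : Type*} [AddCommGroup W'] [Module ℂ W'] (g : W →ₗ[ℂ] W') : Reg W' →ₐ[ℂ] Reg W :=
  SymmetricAlgebra.lift (SymmetricAlgebra.ι ℂ (Dual ℂ W) ∘ₗ g.dualMap)

lemma evalAt_pullback {W' : Type*} [AddCommGroup W'] [Module ℂ W'] (g : W →ₗ[ℂ] W') (w : W)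
    (p : Reg W') : evalAt w (pullback g p) = evalAt (g w) p := by
  have : (evalAt w).comp (pullback g) = evalAt (g w) := by
    apply SymmetricAlgebra.algHom_ext
    ext l
    simp [evalAt, pullback]
  exact DFunLike.congr_fun this p

end Regular

/-! ### Tensors of order two -/

section Tensors

variable {V : Type*} [AddCommGroup V] [Module ℂ V]

/-- A tensor in `V ⊗ V` as a linear map `V^∨ → V`: `v ⊗ w` is `φ ↦ φ(w) v`. -/
def toHom : V ⊗[ℂ] V →ₗ[ℂ] (Dual ℂ V →ₗ[ℂ] V) :=
  dualTensorHom ℂ (Dual ℂ V) V ∘ₗ TensorProduct.map (Dual.eval ℂ V) LinearMap.id ∘ₗ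
    (TensorProduct.comm ℂ V V).toLinearMap

lemma toHom_tmul (v w : V) (φ : Dual ℂ V) : toHom (v ⊗ₜ[ℂ] w) φ = φ w • v := by
  simp [toHom]

/-- The rank of a tensor. -/
def tensorRank (μ : V ⊗[ℂ] V) : ℕ := finrank ℂ (LinearMap.range (toHom μ))

/-- The transpose `μ^t`. -/
def transposeMap : V ⊗[ℂ] V →ₗ[ℂ] V ⊗[ℂ] V := (TensorProduct.comm ℂ V V).toLinearMap

lemma transposeMap_transposeMap (μ : V ⊗[ℂ] V) : transposeMap (transposeMap μ) = μ := by
  induction μ with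
  | zero => simp
  | tmul v w => simp [transposeMap]
  | add x y hx hy => rw [map_add, map_add, hx, hy]

lemma toHom_transposeMap (μ : V ⊗[ℂ] V) (φ ψ : Dual ℂ V) :
    ψ (toHom (transposeMap μ) φ) = φ (toHom μ ψ) := by
  induction μ with
  | zero => simp
  | tmul v w => simp [transposeMap, toHom_tmul, mul_comm]
  | add x y hx hy => simp [map_add, hx, hy]

variable (V) in
/-- `Sym²V`, the symmetric tensors in `V ⊗ V`. -/
def Sym2Tensor : Submodule ℂ (V ⊗[ℂ] V) := LinearMap.eqLocus transposeMap LinearMap.id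

lemma mem_sym2Tensor {α : V ⊗[ℂ] V} : α ∈ Sym2Tensor V ↔ transposeMap α = α := Iff.rfl

/-- The linear map `V ⊗ V → Sym²V`, `μ ↦ μ + μ^t`. -/
def symmetrize : V ⊗[ℂ] V →ₗ[ℂ] Sym2Tensor V :=
  (LinearMap.id + transposeMap).codRestrict (Sym2Tensor V) fun μ => by
    simp [mem_sym2Tensor, transposeMap_transposeMap, add_comm]

variable (V) in
/-- The cone `(V ⊗ V)_1` of tensors of rank at most one. -/
def rankOneCone : Set (V ⊗[ℂ] V) := {μ | tensorRank μ ≤ 1}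

variable (V) in
/-- The set of degenerate symmetric tensors. -/
def degenerate : Set (Sym2Tensor V) := {α | tensorRank (α : V ⊗[ℂ] V) < 3}

lemma zero_mem_rankOneCone : (0 : V ⊗[ℂ] V) ∈ rankOneCone V := by
  change finrank ℂ (LinearMap.range (toHom (0 : V ⊗[ℂ] V))) ≤ 1
  rw [map_zero, LinearMap.range_zero, finrank_bot]
  exact Nat.zero_le 1

lemma zero_mem_degenerate : (0 : Sym2Tensor V) ∈ degenerate V := by
  change finrank ℂ (LinearMap.range (toHom (0 : V ⊗[ℂ] V))) < 3
  rw [map_zero, LinearMap.range_zero, finrank_bot]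
  exact Nat.zero_lt_succ 2

lemma tensorRank_transposeMap [FiniteDimensional ℂ V] (μ : V ⊗[ℂ] V) :
    tensorRank (transposeMap μ) = tensorRank μ := by
  have h : (toHom μ).dualMap = Dual.eval ℂ V ∘ₗ toHom (transposeMap μ) := by
    ext φ ψ
    simp [toHom_transposeMap]
  rw [tensorRank, tensorRank, ← LinearMap.finrank_range_dualMap_eq_finrank_range (toHom μ), h,
    LinearMap.range_comp]
  exact (LinearEquiv.finrank_map_eq (evalEquiv ℂ V) _).symm

lemma tensorRank_symmetrize_lt [FiniteDimensional ℂ V] {μ : V ⊗[ℂ] V} (h : μ ∈ rankOneCone V) :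
    symmetrize μ ∈ degenerate V := by
  have h1 : tensorRank μ ≤ 1 := h
  have h2 : tensorRank (transposeMap μ) ≤ 1 := (tensorRank_transposeMap μ).trans_le h1
  have h3 : LinearMap.range (toHom (symmetrize μ : V ⊗[ℂ] V)) ≤
      LinearMap.range (toHom μ) ⊔ LinearMap.range (toHom (transposeMap μ)) := by
    rintro _ ⟨φ, rfl⟩
    have : (symmetrize μ : V ⊗[ℂ] V) = μ + transposeMap μ := rfl
    rw [this, map_add, LinearMap.add_apply]
    exact Submodule.add_mem_sup ⟨φ, rfl⟩ ⟨φ, rfl⟩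
  have h4 := Submodule.finrank_mono h3
  have h5 := Submodule.finrank_add_le_finrank_add_finrank (LinearMap.range (toHom μ))
    (LinearMap.range (toHom (transposeMap μ)))
  change tensorRank (symmetrize μ : V ⊗[ℂ] V) < 3
  unfold tensorRank at *
  omega

end Tensors

/-! ### The universal double cover -/

section Universal

variable {V : Type*} [AddCommGroup V] [Module ℂ V] [FiniteDimensional ℂ V]

variable (V) in
/-- The ring of regular functions on `Sym²V`. -/
abbrev RegSym : Type _ := Reg (Sym2Tensor V)

/-- A linear map `Sym²V → V` as a `V`-valued regular map on `Sym²V`, i.e. an element of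
`ℂ[Sym²V] ⊗ V`. -/
def linearRegular : (Sym2Tensor V →ₗ[ℂ] V) →ₗ[ℂ] RegSym V ⊗[ℂ] V :=
  (SymmetricAlgebra.ι ℂ (Dual ℂ (Sym2Tensor V))).rTensor V ∘ₗ
    (dualTensorHomEquiv ℂ (Sym2Tensor V) V).symm.toLinearMap

variable (V) in
/-- The tautological map `γ : ℂ[Sym²V] ⊗ V^∨ → ℂ[Sym²V] ⊗ V`: it sends `1 ⊗ φ` to the `V`-valued
map `α ↦ α(φ)`. -/
def tautological : RegSym V ⊗[ℂ] Dual ℂ V →ₗ[RegSym V] RegSym V ⊗[ℂ] V :=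
  (linearRegular ∘ₗ (toHom ∘ₗ (Sym2Tensor V).subtype).flip).liftBaseChange (RegSym V)

lemma repr_linearRegular (b : Basis (Fin 3) ℂ V) (L : Sym2Tensor V →ₗ[ℂ] V) (i : Fin 3) :
    (b.baseChange (RegSym V)).repr (linearRegular L) i =
      SymmetricAlgebra.ι ℂ (Dual ℂ (Sym2Tensor V)) (b.coord i ∘ₗ L) := by
  obtain ⟨t, rfl⟩ := (dualTensorHomEquiv ℂ (Sym2Tensor V) V).surjective L
  simp only [linearRegular, LinearMap.comp_apply, LinearEquiv.coe_coe,
    LinearEquiv.symm_apply_apply]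
  induction t with
  | zero => simp
  | tmul l v =>
    have : b.coord i ∘ₗ (dualTensorHomEquiv ℂ (Sym2Tensor V) V) (l ⊗ₜ[ℂ] v) =
        b.repr v i • l := by
      ext α
      simp [mul_comm]
    rw [this]
    simp
  | add x y hx hy => simp only [map_add, Finsupp.add_apply, hx, hy, LinearMap.comp_add]

lemma tautological_matrix (b : Basis (Fin 3) ℂ V) (i j : Fin 3) :
    LinearMap.toMatrix (b.dualBasis.baseChange (RegSym V)) (b.baseChange (RegSym V))
      (tautological V) i j = SymmetricAlgebra.ι ℂ (Dual ℂ (Sym2Tensor V))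
        (b.coord i ∘ₗ (toHom ∘ₗ (Sym2Tensor V).subtype).flip (b.coord j)) := by
  rw [LinearMap.toMatrix_apply, Basis.baseChange_apply, tautological,
    LinearMap.liftBaseChange_tmul, one_smul, LinearMap.comp_apply, repr_linearRegular]
  simp

/-- The tautological map, with the bases induced by a basis of `V`. -/
def universalPresentation (b : Basis (Fin 3) ℂ V) :
    SymmPresentation (RegSym V) (RegSym V ⊗[ℂ] Dual ℂ V) (RegSym V ⊗[ℂ] V) where
  srcBasis := b.dualBasis.baseChange (RegSym V)
  tgtBasis := b.baseChange (RegSym V)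
  map := tautological V
  isSymm := by
    ext i j
    rw [Matrix.transpose_apply, tautological_matrix, tautological_matrix]
    congr 1
    ext α
    have := toHom_transposeMap (α : V ⊗[ℂ] V) (b.coord i) (b.coord j)
    rw [mem_sym2Tensor.1 α.2] at this
    simpa using this

lemma evalAt_det (b : Basis (Fin 3) ℂ V) (α : Sym2Tensor V) :
    evalAt α (universalPresentation b).mat.det =
      (LinearMap.toMatrix b.dualBasis b (toHom (α : V ⊗[ℂ] V))).det := by
  rw [AlgHom.map_det]
  congr 1
  ext i j
  have : (universalPresentation b).mat i j = _ := tautological_matrix b i j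
  rw [AlgHom.mapMatrix_apply, Matrix.map_apply, this, LinearMap.toMatrix_apply, evalAt,
    SymmetricAlgebra.lift_ι_apply]
  simp

lemma fitt_le_ker_evalAt (b : Basis (Fin 3) ℂ V) {α : Sym2Tensor V} (hα : α ∈ degenerate V)
    (p : RegSym V) (hp : p ∈ (universalPresentation b).fitt) : evalAt α p = 0 := by
  obtain ⟨c, rfl⟩ := Ideal.mem_span_singleton'.1 hp
  rw [map_mul, evalAt_det]
  by_contra hne
  have hdet : (LinearMap.toMatrix b.dualBasis b (toHom (α : V ⊗[ℂ] V))).det ≠ 0 :=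
    right_ne_zero_of_mul hne
  have hr : tensorRank (α : V ⊗[ℂ] V) = 3 := by
    have hb : finrank ℂ V = 3 := by rw [finrank_eq_card_basis b]; rfl
    rw [tensorRank, ← hb]
    rw [LinearMap.range_eq_top.2, finrank_top]
    exact (LinearEquiv.ofIsUnitDet (v := b.dualBasis) (v' := b)
      (f := toHom (α : V ⊗[ℂ] V)) (isUnit_iff_ne_zero.2 hdet)).surjective
  have : tensorRank (α : V ⊗[ℂ] V) < 3 := hα
  omega

/-- The coordinate ring of `Y(V)`, namely `ℂ[Sym²V]/(det M)`. -/
abbrev YRing (b : Basis (Fin 3) ℂ V) : Type _ := RegSym V ⧸ (universalPresentation b).fitt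

/-- The coordinate ring of `X(V)`. -/
abbrev XRing (b : Basis (Fin 3) ℂ V) : Type _ := (universalPresentation b).CoverRing

variable (V) in
/-- The coordinate ring of the (reduced) variety `(V ⊗ V)_1`. -/
abbrev ConeRing : Type _ := Reg (V ⊗[ℂ] V) ⧸ idealOf (rankOneCone V)

/-- The scheme `Y(V)`. -/
abbrev YScheme (b : Basis (Fin 3) ℂ V) : Scheme := Spec (CommRingCat.of (YRing b))

/-- The scheme `X(V)`. -/
abbrev XScheme (b : Basis (Fin 3) ℂ V) : Scheme := Spec (CommRingCat.of (XRing b))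

variable (V) in
/-- The variety `(V ⊗ V)_1`. -/
abbrev ConeScheme : Scheme := Spec (CommRingCat.of (ConeRing V))

/-- The double cover `f : X(V) → Y(V)`. -/
def coverMap (b : Basis (Fin 3) ℂ V) : XScheme b ⟶ YScheme b :=
  Spec.map (CommRingCat.ofHom
    (SymmPresentation.CoverRing.structureHom (universalPresentation b)))

/-- The covering involution of `X(V)`. -/
def coverInvolution (b : Basis (Fin 3) ℂ V) : XScheme b ⟶ XScheme b :=
  Spec.map (CommRingCat.ofHom (SymmPresentation.CoverRing.involution (universalPresentation b)))

/-- The pull-back of functions under `μ ↦ μ + μ^t` from `Y(V)` to `(V ⊗ V)_1`. -/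
def sigmaRingHom (b : Basis (Fin 3) ℂ V) : YRing b →+* ConeRing V :=
  Ideal.Quotient.lift _
    ((Ideal.Quotient.mk (idealOf (rankOneCone V))).comp (pullback symmetrize).toRingHom)
    fun p hp => Ideal.Quotient.eq_zero_iff_mem.2 <| mem_idealOf.2 fun μ hμ =>
      (evalAt_pullback symmetrize μ p).trans
        (fitt_le_ker_evalAt b (tensorRank_symmetrize_lt hμ) p hp)

/-- The map `σ : (V ⊗ V)_1 → Y(V)`, `μ ↦ μ + μ^t`. -/
def sigmaMap (b : Basis (Fin 3) ℂ V) : ConeScheme V ⟶ YScheme b :=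
  Spec.map (CommRingCat.ofHom (sigmaRingHom b))

variable (V) in
/-- The pull-back of functions on `(V ⊗ V)_1` under `μ ↦ μ^t`. -/
def coneTransposeRingHom : ConeRing V →+* ConeRing V :=
  Ideal.Quotient.lift _
    ((Ideal.Quotient.mk (idealOf (rankOneCone V))).comp (pullback transposeMap).toRingHom)
    fun p hp => Ideal.Quotient.eq_zero_iff_mem.2 <| mem_idealOf.2 fun μ hμ =>
      (evalAt_pullback transposeMap μ p).trans
        (mem_idealOf.1 hp _ ((tensorRank_transposeMap μ).trans_le hμ))

variable (V) in
/-- The transposition `μ ↦ μ^t` on `(V ⊗ V)_1`. -/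
def coneTranspose : ConeScheme V ⟶ ConeScheme V :=
  Spec.map (CommRingCat.ofHom (coneTransposeRingHom V))

/-- The fibre coordinates `ξ_k` on `X(V)`: the classes in `N` of the basis vectors of `V`. -/
def xiCoord (b : Basis (Fin 3) ℂ V) (k : Fin 3) : XRing b :=
  SymmPresentation.CoverRing.ofN _ ((universalPresentation b).proj (1 ⊗ₜ[ℂ] b k))

/-- The linear function `μ ↦ μ_{k+1,k+2} - μ_{k+2,k+1}` (indices modulo `3`) on `V ⊗ V`. It is the
`k`-th coordinate of `μ - μ^t ∈ ⋀²V ≅ V^∨ ⊗ ⋀³V ≅ V^∨`. -/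
def skewCoord (b : Basis (Fin 3) ℂ V) (k : Fin 3) : Dual ℂ (V ⊗[ℂ] V) :=
  (b.tensorProduct b).coord (k + 1, k + 2) ∘ₗ (LinearMap.id - transposeMap)

/-- The class of a linear function on `V ⊗ V` in the coordinate ring of `(V ⊗ V)_1`. -/
def coneLinear (l : Dual ℂ (V ⊗[ℂ] V)) : ConeRing V :=
  Ideal.Quotient.mk _ (SymmetricAlgebra.ι ℂ (Dual ℂ (V ⊗[ℂ] V)) l)

/-- The closed point of `(V ⊗ V)_1` given by a tensor of rank at most one. -/
def conePoint (μ : V ⊗[ℂ] V) (hμ : μ ∈ rankOneCone V) : ConeScheme V :=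
  PrimeSpectrum.comap (Ideal.Quotient.lift (idealOf (rankOneCone V)) (evalAt μ).toRingHom
    fun _ hp => mem_idealOf.1 hp μ hμ) (⊥ : PrimeSpectrum ℂ)

/-- The closed point of `Y(V)` given by a degenerate symmetric tensor. -/
def yPoint (b : Basis (Fin 3) ℂ V) (α : Sym2Tensor V) (hα : α ∈ degenerate V) : YScheme b :=
  PrimeSpectrum.comap (Ideal.Quotient.lift (universalPresentation b).fitt (evalAt α).toRingHom
    fun p hp => fitt_le_ker_evalAt b hα p hp) (⊥ : PrimeSpectrum ℂ)

/-- The singular locus of `X(V)`: the points at which `X(V)` is not smooth over `ℂ`. -/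
def singularLocus (b : Basis (Fin 3) ℂ V) : Set (XScheme b) :=
  {x | x ∉ Algebra.smoothLocus ℂ (XRing b)}

end Universal
end

noncomputable section

section Coordinates

variable {V : Type*} [AddCommGroup V] [Module ℂ V]

/-- The coordinate function `μ ↦ μ_{ij}` on `V ⊗ V`. -/
def tensorCoord (b : Basis (Fin 3) ℂ V) (i j : Fin 3) : Dual ℂ (V ⊗[ℂ] V) :=
  (b.tensorProduct b).coord (i, j)

lemma tensorCoord_tmul (b : Basis (Fin 3) ℂ V) (i j : Fin 3) (v w : V) :
    tensorCoord b i j (v ⊗ₜ[ℂ] w) = b.repr v i * b.repr w j := by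
  simp [tensorCoord, mul_comm]

lemma tensorCoord_transposeMap (b : Basis (Fin 3) ℂ V) (i j : Fin 3) (μ : V ⊗[ℂ] V) :
    tensorCoord b i j (transposeMap μ) = tensorCoord b j i μ := by
  induction μ with
  | zero => simp
  | tmul v w => simp [transposeMap, tensorCoord_tmul, mul_comm]
  | add x y hx hy => rw [map_add, map_add, map_add, hx, hy]

lemma coord_toHom (b : Basis (Fin 3) ℂ V) (i j : Fin 3) (μ : V ⊗[ℂ] V) :
    b.coord i (toHom μ (b.coord j)) = tensorCoord b i j μ := by
  induction μ with
  | zero => simp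
  | tmul v w => simp [toHom_tmul, tensorCoord_tmul, mul_comm]
  | add x y hx hy => rw [map_add, map_add, LinearMap.add_apply, map_add, hx, hy]

lemma tensorCoord_ext (b : Basis (Fin 3) ℂ V) {μ ν : V ⊗[ℂ] V}
    (h : ∀ i j, tensorCoord b i j μ = tensorCoord b i j ν) : μ = ν :=
  (b.tensorProduct b).ext_elem fun q => h q.1 q.2

lemma dual_eq_sum_tensorCoord (b : Basis (Fin 3) ℂ V) (l : Dual ℂ (V ⊗[ℂ] V)) :
    l = ∑ i, ∑ j, l (b i ⊗ₜ[ℂ] b j) • tensorCoord b i j := by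
  refine (b.tensorProduct b).ext fun q => ?_
  rw [Basis.tensorProduct_apply]
  simp [tensorCoord_tmul, Finsupp.single_apply]

/-- The tensor with given coordinates. -/
def tensorOfCoord (b : Basis (Fin 3) ℂ V) (A : Fin 3 → Fin 3 → ℂ) : V ⊗[ℂ] V :=
  (b.tensorProduct b).equivFun.symm fun q => A q.1 q.2

lemma tensorCoord_tensorOfCoord (b : Basis (Fin 3) ℂ V) (A : Fin 3 → Fin 3 → ℂ) (i j : Fin 3) :
    tensorCoord b i j (tensorOfCoord b A) = A i j :=
  congrFun ((b.tensorProduct b).equivFun.apply_symm_apply fun q => A q.1 q.2) (i, j)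

lemma tmul_mem_rankOneCone (v w : V) : v ⊗ₜ[ℂ] w ∈ rankOneCone V := by
  have h : LinearMap.range (toHom (v ⊗ₜ[ℂ] w)) ≤ ℂ ∙ v := by
    rintro _ ⟨φ, rfl⟩
    rw [toHom_tmul]
    exact Submodule.smul_mem _ _ (Submodule.mem_span_singleton_self v)
  exact (Submodule.finrank_mono h).trans ((finrank_span_le_card {v}).trans (by simp))

lemma exists_eq_tmul_of_mul (b : Basis (Fin 3) ℂ V) (μ : V ⊗[ℂ] V) (v w : Fin 3 → ℂ)
    (h : ∀ i j, tensorCoord b i j μ = v i * w j) :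
    μ = (b.equivFun.symm v) ⊗ₜ[ℂ] (b.equivFun.symm w) := by
  refine tensorCoord_ext b fun i j => ?_
  rw [h, tensorCoord_tmul, ← b.equivFun_apply, ← b.equivFun_apply, LinearEquiv.apply_symm_apply,
    LinearEquiv.apply_symm_apply]

lemma exists_eq_tmul (b : Basis (Fin 3) ℂ V) {μ : V ⊗[ℂ] V} (hμ : μ ∈ rankOneCone V) :
    ∃ v w : V, μ = v ⊗ₜ[ℂ] w := by
  have : FiniteDimensional ℂ V := b.finiteDimensional_of_finite
  obtain ⟨⟨v, _⟩, hv⟩ := finrank_le_one_iff.1 (show finrank ℂ (LinearMap.range (toHom μ)) ≤ 1 from hμ)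
  choose c hc using fun j => hv ⟨toHom μ (b.coord j), ⟨_, rfl⟩⟩
  refine ⟨_, _, exists_eq_tmul_of_mul b μ (b.repr v) c fun i j => ?_⟩
  have h := congrArg (fun x => b.coord i x.1) (hc j)
  rw [coord_toHom] at h
  rw [← h]
  simp [mul_comm]

lemma exists_eq_tmul_of_minors (b : Basis (Fin 3) ℂ V) (μ : V ⊗[ℂ] V)
    (h : ∀ i j k l, tensorCoord b i j μ * tensorCoord b k l μ =
      tensorCoord b i l μ * tensorCoord b k j μ) : ∃ v w : V, μ = v ⊗ₜ[ℂ] w := by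
  by_cases h0 : ∀ i j, tensorCoord b i j μ = 0
  · exact ⟨0, 0, tensorCoord_ext b fun i j => by simp [h0]⟩
  · push Not at h0
    obtain ⟨i, j, hij⟩ := h0
    refine ⟨_, _, exists_eq_tmul_of_mul b μ (fun k => tensorCoord b k j μ)
      (fun l => tensorCoord b i l μ / tensorCoord b i j μ) fun k l => ?_⟩
    have := h i j k l
    field_simp
    linear_combination this

lemma coe_symmetrize (μ : V ⊗[ℂ] V) :
    (symmetrize μ : V ⊗[ℂ] V) = μ + transposeMap μ := rfl

lemma tensorCoord_symmetrize (b : Basis (Fin 3) ℂ V) (i j : Fin 3) (μ : V ⊗[ℂ] V) :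
    tensorCoord b i j (symmetrize μ : V ⊗[ℂ] V) = tensorCoord b i j μ + tensorCoord b j i μ := by
  rw [coe_symmetrize, map_add, tensorCoord_transposeMap]

/-- A matrix with `C_{ik} C_{jk} = C_{ij} C_{kk}` for all indices is of the
form `z zᵀ`. -/
lemma exists_eq_vecMulVec_self (C : Fin 3 → Fin 3 → ℂ)
    (h : ∀ i j k, C i k * C j k = C i j * C k k) : ∃ z : Fin 3 → ℂ, ∀ i j, C i j = z i * z j := by
  by_cases h0 : ∀ k, C k k = 0
  · refine ⟨0, fun i j => ?_⟩
    have := h i i j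
    rw [h0, zero_mul, mul_self_eq_zero] at this
    simp [this]
  · push Not at h0
    obtain ⟨k, hk⟩ := h0
    obtain ⟨r, hr⟩ := IsAlgClosed.exists_pow_nat_eq (C k k) two_pos
    have hr0 : r ≠ 0 := by
      rintro rfl
      exact hk (by rw [← hr]; simp)
    refine ⟨fun i => C i k / r, fun i j => ?_⟩
    have := h i j k
    rw [← hr] at this
    field_simp
    exact this.symm

lemma adjugate_mul_adjugate_of_det_eq_zero {A : Matrix (Fin 3) (Fin 3) ℂ} (hs : ∀ i j, A i j = A j i)
    (h : A.det = 0) (i j k : Fin 3) :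
    A.adjugate i k * A.adjugate j k = A.adjugate i j * A.adjugate k k := by
  rw [Matrix.det_fin_three] at h
  have h10 := hs 1 0
  have h20 := hs 2 0
  have h21 := hs 2 1
  rw [h10, h20, h21] at h
  rw [Matrix.adjugate_fin_three, h10, h20, h21]
  fin_cases i <;> fin_cases j <;> fin_cases k <;> simp <;> grind

/-- Over `ℂ`, a singular symmetric matrix is `μ + μᵗ` for a matrix `μ` of rank at most one: take
`2 μ = A + [z]` where `[z]` is the skew matrix of a vector with `z zᵀ = -A^c`. -/
lemma exists_symmetrize_tmul (b : Basis (Fin 3) ℂ V) (α : Sym2Tensor V)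
    (h : (Matrix.of fun i j => tensorCoord b i j (α : V ⊗[ℂ] V)).det = 0) :
    ∃ v w : V, α = symmetrize (v ⊗ₜ[ℂ] w) := by
  set A : Matrix (Fin 3) (Fin 3) ℂ := Matrix.of fun i j => tensorCoord b i j (α : V ⊗[ℂ] V) with hA
  have hs : ∀ i j, A i j = A j i := fun i j => by
    rw [hA, Matrix.of_apply, Matrix.of_apply, ← tensorCoord_transposeMap, mem_sym2Tensor.1 α.2]
  obtain ⟨z, hz⟩ := exists_eq_vecMulVec_self (fun i j => -A.adjugate i j) fun i j k => by
    linear_combination adjugate_mul_adjugate_of_det_eq_zero hs h i j k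
  have hMz : ∀ i, A i 0 * z 0 + A i 1 * z 1 + A i 2 * z 2 = 0 := by
    intro i
    by_cases hz0 : ∀ j, z j = 0
    · simp [hz0]
    · push Not at hz0
      obtain ⟨j, hj⟩ := hz0
      have h1 := congrFun (congrFun (Matrix.mul_adjugate A) i) j
      rw [h, zero_smul, Matrix.mul_apply, Fin.sum_univ_three] at h1
      refine (mul_eq_zero.1 ?_).resolve_right hj
      have h2 : (0 : Matrix (Fin 3) (Fin 3) ℂ) i j = 0 := rfl
      linear_combination -h1 - A i 0 * hz 0 j - A i 1 * hz 1 j - A i 2 * hz 2 j - h2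
  let B : Fin 3 → Fin 3 → ℂ := ![![A 0 0 / 2, (A 0 1 + z 2) / 2, (A 0 2 - z 1) / 2],
    ![(A 0 1 - z 2) / 2, A 1 1 / 2, (A 1 2 + z 0) / 2],
    ![(A 0 2 + z 1) / 2, (A 1 2 - z 0) / 2, A 2 2 / 2]]
  have hAd := Matrix.adjugate_fin_three A
  have h10 := hs 1 0
  have h20 := hs 2 0
  have h21 := hs 2 1
  obtain ⟨v, w, hvw⟩ := exists_eq_tmul_of_minors b (tensorOfCoord b B) (by
    simp only [tensorCoord_tensorOfCoord]
    have e00 := hz 0 0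
    have e01 := hz 0 1
    have e02 := hz 0 2
    have e11 := hz 1 1
    have e12 := hz 1 2
    have e22 := hz 2 2
    have m0 := hMz 0
    have m1 := hMz 1
    have m2 := hMz 2
    rw [hAd] at e00 e01 e02 e11 e12 e22
    simp [h10, h20, h21] at e00 e01 e02 e11 e12 e22 m0 m1 m2
    clear hA hs h hz hMz hAd
    intro i j k l
    fin_cases i <;> fin_cases j <;> fin_cases k <;> fin_cases l <;> simp [B] <;> grind)
  refine ⟨v, w, Subtype.ext (tensorCoord_ext b fun i j => ?_)⟩
  rw [← hvw, tensorCoord_symmetrize, tensorCoord_tensorOfCoord, tensorCoord_tensorOfCoord]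
  change A i j = _
  fin_cases i <;> fin_cases j <;> simp [B, h10, h20, h21] <;> ring

end Coordinates
end

noncomputable section

section Determinant

/-- The cubic `det (S + T)` in `T`, for the symmetric matrix `S` with entries
`S₀₀ = 0, S₀₁ = x₀, S₀₂ = x₁, S₁₂ = x₂, S₁₁ = x₃, S₂₂ = x₄`. -/
def charCubic {R : Type*} [CommRing R] (x : Fin 5 → R) : Cubic R :=
  ⟨1, x 3 + x 4, x 3 * x 4 - x 0 ^ 2 - x 1 ^ 2 - x 2 ^ 2,
    2 * x 0 * x 1 * x 2 - x 0 ^ 2 * x 4 - x 1 ^ 2 * x 3⟩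

lemma charCubic_map {R S : Type*} [CommRing R] [CommRing S] (φ : R →+* S) (x : Fin 5 → R) :
    (charCubic x).map φ = charCubic (φ ∘ x) := by
  have h2 : φ 2 = 2 := map_ofNat φ 2
  simp [charCubic, Cubic.map, h2]

/-- A polynomial that vanishes at the zeros of the generic `charCubic` is divisible by it. -/
lemma charCubic_dvd (P : Polynomial (MvPolynomial (Fin 5) ℂ))
    (h : ∀ (s : Fin 5 → ℂ) (t : ℂ), (charCubic s).toPoly.eval t = 0 →
      (P.map (MvPolynomial.eval s)).eval t = 0) :
    (charCubic (MvPolynomial.X : Fin 5 → MvPolynomial (Fin 5) ℂ)).toPoly ∣ P := by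
  set F := (charCubic (MvPolynomial.X : Fin 5 → MvPolynomial (Fin 5) ℂ)).toPoly with hF
  have hmon : F.Monic := Cubic.monic_of_a_eq_one rfl
  have hmap (s : Fin 5 → ℂ) : F.map (MvPolynomial.eval s) = (charCubic s).toPoly := by
    rw [hF, ← Cubic.map_toPoly, charCubic_map]
    congr 2
    ext i
    simp
  rw [← Polynomial.modByMonic_eq_zero_iff_dvd hmon]
  set r := P %ₘ F with hr
  let D : MvPolynomial (Fin 5) ℂ := (charCubic MvPolynomial.X).discr
  have hD (s : Fin 5 → ℂ) : MvPolynomial.eval s D = (charCubic s).discr := by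
    simp [D, charCubic, Cubic.discr]
  have hD0 : D ≠ 0 := by
    intro h0
    have := hD ![0, 0, 0, 1, 2]
    rw [h0] at this
    simp [charCubic, Cubic.discr] at this
    norm_num at this
  have key (s : Fin 5 → ℂ) (hs : MvPolynomial.eval s D ≠ 0) :
      r.map (MvPolynomial.eval s) = 0 := by
    rw [hD] at hs
    have ha : (charCubic s).a ≠ 0 := one_ne_zero
    have hcard : (charCubic s).toPoly.roots.toFinset.card = 3 := by
      have := Cubic.card_roots_of_discr_ne_zero (φ := RingHom.id ℂ) ha
        (by exact IsAlgClosed.splits _) hs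
      simpa [Cubic.map_roots] using this
    have hdeg : (r.map (MvPolynomial.eval s)).degree < 3 := by
      refine Polynomial.degree_map_le.trans_lt ((Polynomial.degree_modByMonic_lt P hmon).trans_eq ?_)
      exact Cubic.degree_of_a_ne_zero one_ne_zero
    refine Polynomial.eq_zero_of_degree_lt_of_eval_finset_eq_zero
      (charCubic s).toPoly.roots.toFinset (by rwa [hcard]) fun t ht => ?_
    have ht' : (charCubic s).toPoly.eval t = 0 :=
      (Polynomial.mem_roots'.1 (Multiset.mem_toFinset.1 ht)).2
    have h1 := congrArg (fun Q => (Polynomial.map (MvPolynomial.eval s) Q).eval t)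
      (Polynomial.modByMonic_add_div P F)
    simpa [hmap, ht', h s t ht'] using h1
  ext1 n
  rw [Polynomial.coeff_zero]
  refine (mul_eq_zero.1 (MvPolynomial.funext fun s => ?_ : D * r.coeff n = 0)).resolve_left hD0
  rw [map_mul, map_zero]
  by_cases hs : MvPolynomial.eval s D = 0
  · rw [hs, zero_mul]
  · rw [← Polynomial.coeff_map, key s hs, Polynomial.coeff_zero, mul_zero]

end Determinant

section Universal

variable {V : Type*} [AddCommGroup V] [Module ℂ V] [FiniteDimensional ℂ V]

lemma universalPresentation_mat (b : Basis (Fin 3) ℂ V) (i j : Fin 3) :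
    (universalPresentation b).mat i j = SymmetricAlgebra.ι ℂ (Dual ℂ (Sym2Tensor V))
      (tensorCoord b i j ∘ₗ (Sym2Tensor V).subtype) := by
  refine (tautological_matrix b i j).trans (congrArg _ ?_)
  ext α
  exact coord_toHom b i j (α : V ⊗[ℂ] V)

lemma universalPresentation_mat_comm (b : Basis (Fin 3) ℂ V) (i j : Fin 3) :
    (universalPresentation b).mat i j = (universalPresentation b).mat j i :=
  congrFun (congrFun (universalPresentation b).mat_isSymm j) i

lemma evalAt_mat (b : Basis (Fin 3) ℂ V) (i j : Fin 3) (α : Sym2Tensor V) :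
    evalAt α ((universalPresentation b).mat i j) = tensorCoord b i j (α : V ⊗[ℂ] V) := by
  simp [universalPresentation_mat, evalAt]

/-- The entries of `M` generate `ℂ[Sym²V]`. -/
lemma adjoin_range_mat (b : Basis (Fin 3) ℂ V) :
    Algebra.adjoin ℂ {p | ∃ i j, p = (universalPresentation b).mat i j} = ⊤ := by
  refine top_unique fun p _ => ?_
  induction p using SymmetricAlgebra.induction with
  | algebraMap r => exact Subalgebra.algebraMap_mem _ r
  | mul x y hx hy => exact mul_mem (hx trivial) (hy trivial)
  | add x y hx hy => exact add_mem (hx trivial) (hy trivial)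
  | ι l =>
    have h : l = ∑ i, ∑ j, ((1 / 2 : ℂ) * l (symmetrize (b i ⊗ₜ[ℂ] b j))) •
        (tensorCoord b i j ∘ₗ (Sym2Tensor V).subtype) := by
      have h1 := dual_eq_sum_tensorCoord b ((1 / 2 : ℂ) • (l ∘ₗ symmetrize))
      ext α
      have h2 : l α = ((1 / 2 : ℂ) • (l ∘ₗ symmetrize)) (α : V ⊗[ℂ] V) := by
        have : symmetrize (α : V ⊗[ℂ] V) = (2 : ℂ) • α := by
          apply Subtype.ext
          rw [coe_symmetrize, mem_sym2Tensor.1 α.2, two_smul]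
          rfl
        simp [this]
      rw [h2, h1]
      simp
    rw [h]
    simp only [map_sum, map_smul, ← universalPresentation_mat]
    refine sum_mem fun i _ => sum_mem fun j _ => Subalgebra.smul_mem _ ?_ _
    exact Algebra.subset_adjoin (Set.mem_ofPred.2 ⟨i, j, rfl⟩)

/-- The parametrization of `ℂ[Sym²V]` by polynomials in `T = M₀₀`. -/
def polynomialToRegSym (b : Basis (Fin 3) ℂ V) :
    Polynomial (MvPolynomial (Fin 5) ℂ) →+* RegSym V :=
  let M := (universalPresentation b).mat
  Polynomial.eval₂RingHom (MvPolynomial.aeval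
    ![M 0 1, M 0 2, M 1 2, M 1 1 - M 0 0, M 2 2 - M 0 0]).toRingHom (M 0 0)

lemma polynomialToRegSym_X (b : Basis (Fin 3) ℂ V) :
    polynomialToRegSym b Polynomial.X = (universalPresentation b).mat 0 0 := by
  simp [polynomialToRegSym]

lemma polynomialToRegSym_C_X (b : Basis (Fin 3) ℂ V) (k : Fin 5) :
    polynomialToRegSym b (Polynomial.C (MvPolynomial.X k)) =
      ![(universalPresentation b).mat 0 1, (universalPresentation b).mat 0 2,
        (universalPresentation b).mat 1 2,
        (universalPresentation b).mat 1 1 - (universalPresentation b).mat 0 0,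
        (universalPresentation b).mat 2 2 - (universalPresentation b).mat 0 0] k := by
  simp [polynomialToRegSym]

lemma polynomialToRegSym_surjective (b : Basis (Fin 3) ℂ V) :
    Function.Surjective (polynomialToRegSym b) := by
  set M := (universalPresentation b).mat with hM
  have h00 : M 0 0 ∈ (polynomialToRegSym b).range := ⟨_, polynomialToRegSym_X b⟩
  have hk (k : Fin 5) : ![M 0 1, M 0 2, M 1 2, M 1 1 - M 0 0, M 2 2 - M 0 0] k ∈
      (polynomialToRegSym b).range := ⟨_, polynomialToRegSym_C_X b k⟩
  have h01 : M 0 1 ∈ (polynomialToRegSym b).range := hk 0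
  have h02 : M 0 2 ∈ (polynomialToRegSym b).range := hk 1
  have h12 : M 1 2 ∈ (polynomialToRegSym b).range := hk 2
  have h11 : M 1 1 ∈ (polynomialToRegSym b).range := by
    simpa using add_mem (hk 3) h00
  have h22 : M 2 2 ∈ (polynomialToRegSym b).range := by
    simpa using add_mem (hk 4) h00
  have hc := universalPresentation_mat_comm b
  have h10 : M 1 0 ∈ (polynomialToRegSym b).range := by rw [hM, hc]; exact h01
  have h20 : M 2 0 ∈ (polynomialToRegSym b).range := by rw [hM, hc]; exact h02
  have h21 : M 2 1 ∈ (polynomialToRegSym b).range := by rw [hM, hc]; exact h12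
  intro p
  change p ∈ (polynomialToRegSym b).range
  have hp : p ∈ Algebra.adjoin ℂ {p | ∃ i j, p = M i j} := by
    rw [adjoin_range_mat]; trivial
  induction hp using Algebra.adjoin_induction with
  | mem x hx =>
    obtain ⟨i, j, rfl⟩ := hx
    fin_cases i <;> fin_cases j
    exacts [h00, h01, h02, h10, h11, h12, h20, h21, h22]
  | algebraMap r =>
    exact ⟨Polynomial.C (MvPolynomial.C r), by simp [polynomialToRegSym]⟩
  | add x y _ _ hx hy => exact add_mem hx hy
  | mul x y _ _ hx hy => exact mul_mem hx hy

lemma polynomialToRegSym_charCubic (b : Basis (Fin 3) ℂ V) :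
    polynomialToRegSym b (charCubic MvPolynomial.X).toPoly = (universalPresentation b).mat.det := by
  have hc := universalPresentation_mat_comm b
  rw [Matrix.det_fin_three, hc 1 0, hc 2 0, hc 2 1]
  simp only [charCubic, Cubic.toPoly, map_add, map_sub, map_mul, map_pow, map_one, map_ofNat,
    polynomialToRegSym_X, polynomialToRegSym_C_X]
  simp
  ring

lemma evalAt_polynomialToRegSym (b : Basis (Fin 3) ℂ V) (α : Sym2Tensor V) (s : Fin 5 → ℂ) (t : ℂ)
    (h00 : tensorCoord b 0 0 (α : V ⊗[ℂ] V) = t)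
    (h01 : tensorCoord b 0 1 (α : V ⊗[ℂ] V) = s 0)
    (h02 : tensorCoord b 0 2 (α : V ⊗[ℂ] V) = s 1)
    (h12 : tensorCoord b 1 2 (α : V ⊗[ℂ] V) = s 2)
    (h11 : tensorCoord b 1 1 (α : V ⊗[ℂ] V) = t + s 3)
    (h22 : tensorCoord b 2 2 (α : V ⊗[ℂ] V) = t + s 4)
    (P : Polynomial (MvPolynomial (Fin 5) ℂ)) :
    evalAt α (polynomialToRegSym b P) = (P.map (MvPolynomial.eval s)).eval t := by
  have : (evalAt α).toRingHom.comp (polynomialToRegSym b) =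
      (Polynomial.evalRingHom t).comp (Polynomial.mapRingHom (MvPolynomial.eval s)) := by
    apply Polynomial.ringHom_ext'
    · apply MvPolynomial.ringHom_ext
      · intro r
        simp [polynomialToRegSym]
      · intro k
        fin_cases k <;> simp [polynomialToRegSym, evalAt_mat, h00, h01, h02, h12, h11, h22]
    · simp [polynomialToRegSym, evalAt_mat, h00]
  exact DFunLike.congr_fun this P

/-- A regular function on `Sym²V` that vanishes at all `v ⊗ w + w ⊗ v` is a multiple of `det M`. -/
lemma mem_fitt_of_evalAt_symmetrize (b : Basis (Fin 3) ℂ V) {p : RegSym V}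
    (hp : ∀ v w : V, evalAt (symmetrize (v ⊗ₜ[ℂ] w)) p = 0) :
    p ∈ (universalPresentation b).fitt := by
  obtain ⟨P, rfl⟩ := polynomialToRegSym_surjective b p
  suffices h : (charCubic MvPolynomial.X).toPoly ∣ P by
    rw [SymmPresentation.fitt, Ideal.mem_span_singleton, ← polynomialToRegSym_charCubic]
    exact map_dvd _ h
  refine charCubic_dvd P fun s t hst => ?_
  let B : Fin 3 → Fin 3 → ℂ := ![![t, s 0, s 1], ![s 0, t + s 3, s 2], ![s 1, s 2, t + s 4]]
  let α : Sym2Tensor V := ⟨tensorOfCoord b B, by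
    refine mem_sym2Tensor.2 (tensorCoord_ext b fun i j => ?_)
    rw [tensorCoord_transposeMap, tensorCoord_tensorOfCoord, tensorCoord_tensorOfCoord]
    fin_cases i <;> fin_cases j <;> rfl⟩
  have hα (i j : Fin 3) : tensorCoord b i j (α : V ⊗[ℂ] V) = B i j :=
    tensorCoord_tensorOfCoord b B i j
  have hev := evalAt_polynomialToRegSym b α s t (hα 0 0) (hα 0 1) (hα 0 2) (hα 1 2) (hα 1 1) (hα 2 2)
  obtain ⟨v, w, hvw⟩ := exists_symmetrize_tmul b α (by
    rw [Matrix.det_fin_three]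
    simp only [Matrix.of_apply, hα]
    simp [charCubic, Cubic.toPoly] at hst
    simp [B]
    linear_combination hst)
  rw [← hev, hvw, hp]

/-- The ideal of the variety of degenerate symmetric tensors is generated by `det M`. -/
theorem idealOf_degenerate (b : Basis (Fin 3) ℂ V) :
    idealOf (degenerate V) = (universalPresentation b).fitt := by
  refine le_antisymm (fun p hp => ?_) fun p hp => ?_
  · exact mem_fitt_of_evalAt_symmetrize b fun v w => mem_idealOf.1 hp _
      (tensorRank_symmetrize_lt (tmul_mem_rankOneCone v w))
  · exact mem_idealOf.2 fun α hα => fitt_le_ker_evalAt b hα p hp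

end Universal
end

noncomputable section

section ConeFunctions

variable {V : Type*} [AddCommGroup V] [Module ℂ V]

/-- Evaluation of functions on `(V ⊗ V)_1` at a point. -/
def coneEval (μ : V ⊗[ℂ] V) (hμ : μ ∈ rankOneCone V) : ConeRing V →ₐ[ℂ] ℂ :=
  Ideal.Quotient.liftₐ (idealOf (rankOneCone V)) (evalAt μ) fun _ hp => mem_idealOf.1 hp μ hμ

lemma coneEval_mk (μ : V ⊗[ℂ] V) (hμ : μ ∈ rankOneCone V) (p : Reg (V ⊗[ℂ] V)) :
    coneEval μ hμ (Ideal.Quotient.mk _ p) = evalAt μ p := rfl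

lemma coneEval_coneLinear (μ : V ⊗[ℂ] V) (hμ : μ ∈ rankOneCone V) (l : Dual ℂ (V ⊗[ℂ] V)) :
    coneEval μ hμ (coneLinear l) = l μ := by
  rw [coneLinear, coneEval_mk, evalAt, SymmetricAlgebra.lift_ι_apply, Dual.eval_apply]

lemma coneRing_ext {x y : ConeRing V} (h : ∀ μ hμ, coneEval μ hμ x = coneEval μ hμ y) : x = y := by
  obtain ⟨p, rfl⟩ := Ideal.Quotient.mk_surjective x
  obtain ⟨q, rfl⟩ := Ideal.Quotient.mk_surjective y
  refine Ideal.Quotient.eq.2 (mem_idealOf.2 fun μ hμ => ?_)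
  rw [map_sub, sub_eq_zero]
  exact h μ hμ

lemma coneRing_ext_tmul (b : Basis (Fin 3) ℂ V) {x y : ConeRing V}
    (h : ∀ v w, coneEval (v ⊗ₜ[ℂ] w) (tmul_mem_rankOneCone v w) x =
      coneEval (v ⊗ₜ[ℂ] w) (tmul_mem_rankOneCone v w) y) : x = y := by
  refine coneRing_ext fun μ hμ => ?_
  obtain ⟨v, w, rfl⟩ := exists_eq_tmul b hμ
  exact h v w

/-- The coordinate functions generate the coordinate ring of `(V ⊗ V)_1`. -/
lemma adjoin_range_coneLinear (b : Basis (Fin 3) ℂ V) :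
    Algebra.adjoin ℂ {x : ConeRing V | ∃ i j, x = coneLinear (tensorCoord b i j)} = ⊤ := by
  refine top_unique fun x _ => ?_
  obtain ⟨p, rfl⟩ := Ideal.Quotient.mk_surjective x
  induction p using SymmetricAlgebra.induction with
  | algebraMap r => exact Subalgebra.algebraMap_mem _ r
  | mul x y hx hy => rw [map_mul]; exact mul_mem (hx trivial) (hy trivial)
  | add x y hx hy => rw [map_add]; exact add_mem (hx trivial) (hy trivial)
  | ι l =>
    have h : Ideal.Quotient.mk (idealOf (rankOneCone V)) (SymmetricAlgebra.ι ℂ _ l) =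
        ∑ i, ∑ j, l (b i ⊗ₜ[ℂ] b j) • coneLinear (tensorCoord b i j) := by
      refine coneRing_ext fun μ hμ => ?_
      change coneEval μ hμ (coneLinear l) = _
      simp only [map_sum, map_smul, coneEval_coneLinear]
      conv_lhs => rw [dual_eq_sum_tensorCoord b l]
      simp
    rw [h]
    refine sum_mem fun i _ => sum_mem fun j _ => Subalgebra.smul_mem _ ?_ _
    exact Algebra.subset_adjoin (Set.mem_ofPred.2 ⟨i, j, rfl⟩)

lemma skewCoord_tmul (b : Basis (Fin 3) ℂ V) (k : Fin 3) (v w : V) :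
    skewCoord b k (v ⊗ₜ[ℂ] w) =
      b.repr v (k + 1) * b.repr w (k + 2) - b.repr v (k + 2) * b.repr w (k + 1) := by
  change tensorCoord b (k + 1) (k + 2) (v ⊗ₜ[ℂ] w - transposeMap (v ⊗ₜ[ℂ] w)) = _
  rw [map_sub, tensorCoord_transposeMap, tensorCoord_tmul, tensorCoord_tmul]

end ConeFunctions

namespace SymmPresentation

variable {R U₁ U₀ : Type*} [CommRing R] [AddCommGroup U₁] [Module R U₁]
  [AddCommGroup U₀] [Module R U₀] (S : SymmPresentation R U₁ U₀)

/-- The multiplication on `N` is non-degenerate. -/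
lemma eq_zero_of_pairing_eq_zero (hdet : S.mat.det ∈ nonZeroDivisors R) {n : S.N}
    (h : ∀ n', S.pairing n' n = 0) : n = 0 := by
  obtain ⟨u, rfl⟩ := S.proj_surjective n
  have h1 (i : Fin 3) : S.mat.det ∣ S.mat.adjugate.mulVec (S.tgtBasis.repr u) i := by
    have := h (S.proj (S.tgtBasis i))
    rw [pairing_proj, Ideal.Quotient.eq_zero_iff_mem, fitt, Ideal.mem_span_singleton,
      cofactorForm_apply, Basis.repr_self] at this
    rwa [Finsupp.single_eq_pi_single, single_one_dotProduct] at this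
  choose z hz using h1
  refine S.proj_eq_zero u z (funext fun i => (mul_cancel_left_mem_nonZeroDivisors hdet).1 ?_)
  have h2 : S.mat.adjugate.mulVec (S.tgtBasis.repr u) = S.mat.det • z := funext hz
  have h3 := congrFun (congrArg S.mat.mulVec h2) i
  rwa [Matrix.mulVec_mulVec, Matrix.mul_adjugate, Matrix.smul_mulVec, Matrix.one_mulVec,
    Matrix.mulVec_smul] at h3

/-- A map out of the cover: an `R/(det M)`-algebra with elements `x_k` that satisfy the relations
of `N` and of the multiplication. -/
structure CoverMap (C : Type*) [CommRing C] where
  base : R ⧸ S.fitt →+* C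
  x : Fin 3 → C
  sum_mat_mul : ∀ j, ∑ k, base (Ideal.Quotient.mk _ (S.mat k j)) * x k = 0
  mul : ∀ i j, x i * x j = base (Ideal.Quotient.mk _ (S.mat.adjugate i j))

namespace CoverMap

variable {S} {C : Type*} [CommRing C] (φ : S.CoverMap C)

/-- The composite `R → R/(det M) → C`. -/
def coeff : R →+* C := φ.base.comp (Ideal.Quotient.mk _)

lemma coeff_apply (r : R) : φ.base (Ideal.Quotient.mk _ r) = φ.coeff r := rfl

/-- The map `U₀ → C` sending the basis vectors to the `x_k`. -/
def oddLift : U₀ →ₛₗ[φ.coeff] C where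
  toFun u := ∑ k, φ.coeff (S.tgtBasis.repr u k) * φ.x k
  map_add' u v := by simp [add_mul, Finset.sum_add_distrib]
  map_smul' r u := by simp [Finset.mul_sum, mul_assoc]

lemma oddLift_apply (u : U₀) :
    φ.oddLift u = ∑ k, φ.coeff (S.tgtBasis.repr u k) * φ.x k := rfl

lemma oddLift_map (y : U₁) : φ.oddLift (S.map y) = 0 := by
  rw [oddLift_apply, repr_map]
  simp only [Matrix.mulVec, dotProduct, map_sum, map_mul, Finset.sum_mul]
  rw [Finset.sum_comm]
  refine Finset.sum_eq_zero fun j _ => ?_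
  rw [← mul_zero (φ.coeff (S.srcBasis.repr y j)), ← φ.sum_mat_mul j, Finset.mul_sum]
  exact Finset.sum_congr rfl fun k _ => by rw [coeff_apply]; ring

/-- The map `N → C`. -/
def oddPart : S.N →ₛₗ[φ.coeff] C :=
  (LinearMap.range S.map).liftQ φ.oddLift (by
    rintro _ ⟨y, rfl⟩
    exact φ.oddLift_map y)

lemma oddPart_proj (u : U₀) : φ.oddPart (S.proj u) = φ.oddLift u := rfl

lemma oddPart_smul (r : R ⧸ S.fitt) (n : S.N) : φ.oddPart (r • n) = φ.base r * φ.oddPart n := by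
  obtain ⟨r, rfl⟩ := Ideal.Quotient.mk_surjective r
  exact φ.oddPart.map_smulₛₗ r n

lemma oddPart_mul_oddPart (n n' : S.N) :
    φ.oddPart n * φ.oddPart n' = φ.base (S.pairing n n') := by
  obtain ⟨u, rfl⟩ := S.proj_surjective n
  obtain ⟨v, rfl⟩ := S.proj_surjective n'
  rw [pairing_proj, oddPart_proj, oddPart_proj, coeff_apply, cofactorForm_apply, oddLift_apply,
    oddLift_apply]
  simp only [dotProduct, Matrix.mulVec, map_sum, map_mul, Finset.sum_mul, Finset.mul_sum]
  rw [Finset.sum_comm]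
  refine Finset.sum_congr rfl fun i _ => Finset.sum_congr rfl fun j _ => ?_
  rw [← coeff_apply φ (S.mat.adjugate _ _), ← φ.mul]
  ring

/-- The ring homomorphism `(r, n) ↦ r + n`. -/
def toRingHom : S.CoverRing →+* C where
  toFun y := φ.base y.fst + φ.oddPart y.snd
  map_one' := by rw [CoverRing.fst_one, CoverRing.snd_one, map_one, map_zero, add_zero]
  map_zero' := by rw [CoverRing.fst_zero, CoverRing.snd_zero, map_zero, map_zero, add_zero]
  map_add' y z := by rw [CoverRing.fst_add, CoverRing.snd_add, map_add, map_add]; ring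
  map_mul' y z := by
    rw [CoverRing.fst_mul, CoverRing.snd_mul, map_add, map_add, map_mul, oddPart_smul,
      oddPart_smul, ← oddPart_mul_oddPart]
    ring

lemma toRingHom_apply (y : S.CoverRing) :
    φ.toRingHom y = φ.base y.fst + φ.oddPart y.snd := rfl

lemma toRingHom_structureHom (r : R ⧸ S.fitt) :
    φ.toRingHom (CoverRing.structureHom S r) = φ.base r := by
  change φ.base r + φ.oddPart 0 = _
  rw [map_zero, add_zero]

lemma toRingHom_ofN_proj (k : Fin 3) :
    φ.toRingHom (CoverRing.ofN S (S.proj (S.tgtBasis k))) = φ.x k := by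
  change φ.base 0 + φ.oddLift (S.tgtBasis k) = _
  rw [map_zero, zero_add, oddLift_apply, Basis.repr_self]
  simp [Finsupp.single_apply]

lemma apply_toRingHom (θ : C →+* C) (h0 : ∀ r, θ (φ.base r) = φ.base r)
    (h1 : ∀ k, θ (φ.x k) = -φ.x k) (y : S.CoverRing) :
    θ (φ.toRingHom y) = φ.toRingHom (CoverRing.involution S y) := by
  change _ = φ.base y.fst + φ.oddPart (-y.snd)
  rw [toRingHom_apply, map_add, h0, map_neg]
  congr 1
  obtain ⟨u, hu⟩ := S.proj_surjective y.snd
  rw [← hu, oddPart_proj, oddLift_apply, map_sum, ← Finset.sum_neg_distrib]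
  refine Finset.sum_congr rfl fun k _ => ?_
  rw [map_mul, h1, ← coeff_apply, h0, mul_neg]

lemma toRingHom_injective (hdet : S.mat.det ∈ nonZeroDivisors R)
    (hbase : Function.Injective φ.base) (h2 : ∀ c : C, c + c = 0 → c = 0)
    (θ : C →+* C) (h0 : ∀ r, θ (φ.base r) = φ.base r) (h1 : ∀ k, θ (φ.x k) = -φ.x k) :
    Function.Injective φ.toRingHom := by
  refine (injective_iff_map_eq_zero _).2 fun y hy => ?_
  have e1 : φ.base y.fst + φ.oddPart y.snd = 0 := hy
  have e2 : 0 = φ.base y.fst + φ.oddPart (-y.snd) := by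
    have := φ.apply_toRingHom θ h0 h1 y
    rwa [hy, map_zero] at this
  rw [map_neg] at e2
  have hodd : φ.oddPart y.snd = 0 := h2 _ (by linear_combination e1 + e2)
  have heven : y.fst = 0 := hbase (by rw [map_zero, ← e1, hodd, add_zero])
  have hsnd : y.snd = 0 := S.eq_zero_of_pairing_eq_zero hdet fun n' =>
    hbase (by rw [map_zero, ← oddPart_mul_oddPart, hodd, mul_zero])
  exact CoverRing.ext heven hsnd

end CoverMap

end SymmPresentation

end

noncomputable section

section Isomorphism

variable {V : Type*} [AddCommGroup V] [Module ℂ V]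

/-- The image `√-1 (μ_{k+1,k+2} - μ_{k+2,k+1})` of `ξ_k`. -/
def xiImage (b : Basis (Fin 3) ℂ V) (k : Fin 3) : ConeRing V :=
  Complex.I • coneLinear (skewCoord b k)

lemma coneEval_xiImage (b : Basis (Fin 3) ℂ V) (k : Fin 3) (v w : V) :
    coneEval (v ⊗ₜ[ℂ] w) (tmul_mem_rankOneCone v w) (xiImage b k) = Complex.I *
      (b.repr v (k + 1) * b.repr w (k + 2) - b.repr v (k + 2) * b.repr w (k + 1)) := by
  rw [xiImage, map_smul, coneEval_coneLinear, skewCoord_tmul, smul_eq_mul]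

variable [FiniteDimensional ℂ V]

lemma coneEval_sigmaRingHom (b : Basis (Fin 3) ℂ V) (μ : V ⊗[ℂ] V) (hμ : μ ∈ rankOneCone V)
    (p : RegSym V) : coneEval μ hμ (sigmaRingHom b (Ideal.Quotient.mk _ p)) =
      evalAt (symmetrize μ) p :=
  evalAt_pullback symmetrize μ p

lemma coneEval_sigmaRingHom_mat (b : Basis (Fin 3) ℂ V) (i j : Fin 3) (v w : V) :
    coneEval (v ⊗ₜ[ℂ] w) (tmul_mem_rankOneCone v w)
      (sigmaRingHom b (Ideal.Quotient.mk _ ((universalPresentation b).mat i j))) =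
      b.repr v i * b.repr w j + b.repr v j * b.repr w i := by
  rw [coneEval_sigmaRingHom, evalAt_mat, tensorCoord_symmetrize, tensorCoord_tmul,
    tensorCoord_tmul]

lemma xiImage_mul_xiImage (b : Basis (Fin 3) ℂ V) (i j : Fin 3) :
    xiImage b i * xiImage b j =
      sigmaRingHom b (Ideal.Quotient.mk _ ((universalPresentation b).mat.adjugate i j)) := by
  refine coneRing_ext_tmul b fun v w => ?_
  have hI := Complex.I_mul_I
  have hM (i j : Fin 3) : evalAt (symmetrize (v ⊗ₜ[ℂ] w)) ((universalPresentation b).mat i j) =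
      b.repr v i * b.repr w j + b.repr v j * b.repr w i := by
    rw [evalAt_mat, tensorCoord_symmetrize, tensorCoord_tmul, tensorCoord_tmul]
  rw [map_mul, coneEval_xiImage, coneEval_xiImage, coneEval_sigmaRingHom,
    Matrix.adjugate_fin_three]
  fin_cases i <;> fin_cases j <;> simp [hM] <;> grind

lemma sum_mat_mul_xiImage (b : Basis (Fin 3) ℂ V) (j : Fin 3) :
    ∑ k, sigmaRingHom b (Ideal.Quotient.mk _ ((universalPresentation b).mat k j)) *
      xiImage b k = 0 := by
  refine coneRing_ext_tmul b fun v w => ?_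
  rw [map_sum, map_zero]
  simp_rw [map_mul, coneEval_xiImage, coneEval_sigmaRingHom_mat]
  simp [Fin.sum_univ_three]
  ring

/-- The data of the map `τ^*` of coordinate rings. -/
def tauMap (b : Basis (Fin 3) ℂ V) : (universalPresentation b).CoverMap (ConeRing V) where
  base := sigmaRingHom b
  x := xiImage b
  sum_mat_mul := sum_mat_mul_xiImage b
  mul := xiImage_mul_xiImage b

/-- The map `τ^*` of coordinate rings. -/
def tauHom (b : Basis (Fin 3) ℂ V) : XRing b →ₐ[ℂ] ConeRing V where
  __ := (tauMap b).toRingHom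
  commutes' r := by
    refine ((tauMap b).toRingHom_structureHom _).trans (coneRing_ext fun μ hμ => ?_)
    refine (coneEval_sigmaRingHom b μ hμ (algebraMap ℂ _ r)).trans ?_
    rw [AlgHom.commutes, AlgHom.commutes]

lemma tauHom_structureHom (b : Basis (Fin 3) ℂ V) (r : YRing b) :
    tauHom b (SymmPresentation.CoverRing.structureHom _ r) = sigmaRingHom b r :=
  (tauMap b).toRingHom_structureHom r

lemma tauHom_xiCoord (b : Basis (Fin 3) ℂ V) (k : Fin 3) :
    tauHom b (xiCoord b k) = xiImage b k := by
  have h : (1 : RegSym V) ⊗ₜ[ℂ] b k = (universalPresentation b).tgtBasis k :=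
    (Basis.baseChange_apply (RegSym V) b k).symm
  rw [xiCoord, h]
  exact (tauMap b).toRingHom_ofN_proj k

lemma transposeMap_mem_rankOneCone {μ : V ⊗[ℂ] V} (hμ : μ ∈ rankOneCone V) :
    transposeMap μ ∈ rankOneCone V :=
  (tensorRank_transposeMap μ).trans_le hμ

lemma coneEval_coneTranspose (μ : V ⊗[ℂ] V) (hμ : μ ∈ rankOneCone V) (x : ConeRing V) :
    coneEval μ hμ (coneTransposeRingHom V x) =
      coneEval (transposeMap μ) (transposeMap_mem_rankOneCone hμ) x := by
  obtain ⟨p, rfl⟩ := Ideal.Quotient.mk_surjective x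
  exact evalAt_pullback transposeMap μ p

lemma coneTranspose_sigmaRingHom (b : Basis (Fin 3) ℂ V) (r : YRing b) :
    coneTransposeRingHom V (sigmaRingHom b r) = sigmaRingHom b r := by
  obtain ⟨p, rfl⟩ := Ideal.Quotient.mk_surjective r
  refine coneRing_ext fun μ hμ => ?_
  rw [coneEval_coneTranspose, coneEval_sigmaRingHom, coneEval_sigmaRingHom]
  congr 2
  apply Subtype.ext
  rw [coe_symmetrize, coe_symmetrize, transposeMap_transposeMap, add_comm]

lemma coneTranspose_xiImage (b : Basis (Fin 3) ℂ V) (k : Fin 3) :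
    coneTransposeRingHom V (xiImage b k) = -xiImage b k := by
  refine coneRing_ext_tmul b fun v w => ?_
  have h : transposeMap (v ⊗ₜ[ℂ] w) = w ⊗ₜ[ℂ] v := rfl
  rw [coneEval_coneTranspose, map_neg, coneEval_xiImage]
  simp only [h, coneEval_xiImage]
  ring

lemma coneTranspose_tauHom (b : Basis (Fin 3) ℂ V) (x : XRing b) :
    coneTransposeRingHom V (tauHom b x) =
      tauHom b (SymmPresentation.CoverRing.involution _ x) :=
  (tauMap b).apply_toRingHom (coneTransposeRingHom V) (coneTranspose_sigmaRingHom b)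
    (coneTranspose_xiImage b) x

lemma sigmaRingHom_injective (b : Basis (Fin 3) ℂ V) : Function.Injective (sigmaRingHom b) := by
  refine (injective_iff_map_eq_zero _).2 fun r hr => ?_
  obtain ⟨p, rfl⟩ := Ideal.Quotient.mk_surjective r
  refine Ideal.Quotient.eq_zero_iff_mem.2 (mem_fitt_of_evalAt_symmetrize b fun v w => ?_)
  rw [← coneEval_sigmaRingHom b _ (tmul_mem_rankOneCone v w), hr, map_zero]

lemma det_mem_nonZeroDivisors (b : Basis (Fin 3) ℂ V) :
    (universalPresentation b).mat.det ∈ nonZeroDivisors (RegSym V) := by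
  refine mem_nonZeroDivisors_of_ne_zero fun h => ?_
  have hs : transposeMap (tensorOfCoord b fun i j => if i = j then 1 else 0) =
      tensorOfCoord b fun i j => if i = j then 1 else 0 := tensorCoord_ext b fun i j => by
    rw [tensorCoord_transposeMap, tensorCoord_tensorOfCoord, tensorCoord_tensorOfCoord]
    exact if_congr eq_comm rfl rfl
  have h1 := evalAt_det b ⟨_, mem_sym2Tensor.2 hs⟩
  have h2 : LinearMap.toMatrix b.dualBasis b
      (toHom (tensorOfCoord b fun i j => if i = j then 1 else 0)) = 1 := by
    ext i j
    rw [LinearMap.toMatrix_apply, Basis.coe_dualBasis, ← Basis.coord_apply, coord_toHom,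
      tensorCoord_tensorOfCoord, Matrix.one_apply]
  rw [h2, Matrix.det_one, h, map_zero] at h1
  exact zero_ne_one h1

lemma tauHom_injective (b : Basis (Fin 3) ℂ V) : Function.Injective (tauHom b) := by
  refine (tauMap b).toRingHom_injective (det_mem_nonZeroDivisors b) (sigmaRingHom_injective b)
    (fun c hc => coneRing_ext fun μ hμ => ?_) (coneTransposeRingHom V)
    (coneTranspose_sigmaRingHom b) (coneTranspose_xiImage b)
  have h := congrArg (coneEval μ hμ) hc
  rw [map_add, map_zero] at h
  rw [map_zero]
  linear_combination h / 2

/-- The coordinates of `μ` in terms of those of `μ + μ^t` and `μ - μ^t`. -/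
lemma exists_coneLinear_eq (b : Basis (Fin 3) ℂ V) (i j : Fin 3) :
    ∃ c : Fin 3 → ℂ, coneLinear (tensorCoord b i j) =
      (1 / 2 : ℂ) • sigmaRingHom b (Ideal.Quotient.mk _ ((universalPresentation b).mat i j)) +
      ∑ k, c k • xiImage b k := by
  let t : Fin 3 → Fin 3 → Fin 3 → ℂ := ![![0, ![0, 0, 1], ![0, -1, 0]],
    ![![0, 0, -1], 0, ![1, 0, 0]], ![![0, 1, 0], ![-1, 0, 0], 0]]
  refine ⟨fun k => -Complex.I / 2 * t i j k, coneRing_ext_tmul b fun v w => ?_⟩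
  have hI := Complex.I_mul_I
  rw [map_add, map_smul, map_sum, coneEval_coneLinear, tensorCoord_tmul,
    coneEval_sigmaRingHom_mat]
  simp_rw [map_smul, coneEval_xiImage, Fin.sum_univ_three]
  fin_cases i <;> fin_cases j <;> simp [t] <;> grind

lemma tauHom_surjective (b : Basis (Fin 3) ℂ V) : Function.Surjective (tauHom b) := by
  suffices h : (tauHom b).range = ⊤ from AlgHom.range_eq_top _ |>.1 h
  rw [← top_le_iff, ← adjoin_range_coneLinear b, Algebra.adjoin_le_iff]
  rintro _ ⟨i, j, rfl⟩
  have hev : sigmaRingHom b (Ideal.Quotient.mk _ ((universalPresentation b).mat i j)) ∈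
      (tauHom b).range := ⟨_, tauHom_structureHom b _⟩
  have hodd (k : Fin 3) : xiImage b k ∈ (tauHom b).range := ⟨_, tauHom_xiCoord b k⟩
  obtain ⟨c, hc⟩ := exists_coneLinear_eq b i j
  rw [hc]
  exact add_mem (Subalgebra.smul_mem _ hev _)
    (sum_mem fun k _ => Subalgebra.smul_mem _ (hodd k) _)

/-- The isomorphism `τ^*` of coordinate rings. -/
def tauEquiv (b : Basis (Fin 3) ℂ V) : XRing b ≃ₐ[ℂ] ConeRing V :=
  AlgEquiv.ofBijective (tauHom b) ⟨tauHom_injective b, tauHom_surjective b⟩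

end Isomorphism
end

noncomputable section

section SmoothLocus

/-- If `A[1/x]` is a localization of a formally smooth subalgebra `P ∋ x`, then `A` is smooth where
`x` does not vanish. -/
lemma mem_smoothLocus_of_subalgebra {k P A : Type*} [CommRing k] [CommRing P] [CommRing A]
    [Algebra k P] [Algebra k A] [Algebra.FormallySmooth k P] (g : P →ₐ[k] A)
    (hinj : Function.Injective g) (x : P) (h : ∀ a : A, ∃ (n : ℕ) (p : P), g x ^ n * a = g p)
    (q : PrimeSpectrum A) (hq : g x ∉ q.asIdeal) : q ∈ Algebra.smoothLocus k A := by
  let : Algebra P A := g.toRingHom.toAlgebra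
  have : IsScalarTower k P A := .of_algHom g
  have hg (p : P) : g p = algebraMap P A p := rfl
  simp only [hg] at h hq
  set y := algebraMap P A x with hy
  let L := Localization.Away y
  have hloc : IsLocalization.Away x L := by
    have hyu : IsUnit (algebraMap A L y) := IsLocalization.Away.algebraMap_isUnit y
    refine ⟨?_, ?_, ?_⟩
    · rintro ⟨_, n, rfl⟩
      rw [IsScalarTower.algebraMap_apply P A L]
      simpa using hyu.pow n
    · intro z
      obtain ⟨⟨a, _, m, rfl⟩, hz⟩ := IsLocalization.surj (Submonoid.powers y) z
      obtain ⟨n, p, hp⟩ := h a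
      refine ⟨(p, ⟨x ^ (n + m), n + m, rfl⟩), ?_⟩
      simp only [IsScalarTower.algebraMap_apply P A L, ← hp, map_pow, map_mul, pow_add, ← hy] at hz ⊢
      rw [← hz]
      ring
    · intro p p' hpp
      rw [IsScalarTower.algebraMap_apply P A L, IsScalarTower.algebraMap_apply P A L] at hpp
      obtain ⟨⟨_, n, rfl⟩, hn⟩ := (IsLocalization.eq_iff_exists (Submonoid.powers y) L).1 hpp
      refine ⟨⟨x ^ n, n, rfl⟩, hinj ?_⟩
      simpa [hy, hg] using hn
  have : Algebra.FormallySmooth P L := .of_isLocalization (Submonoid.powers x)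
  have : Algebra.FormallySmooth k L := .comp k P L
  have hmem : q ∈ Set.range (PrimeSpectrum.comap (algebraMap A L)) := by
    rw [PrimeSpectrum.localization_away_comap_range L y]
    exact hq
  obtain ⟨q', rfl⟩ := hmem
  change q' ∈ PrimeSpectrum.comap (algebraMap A L) ⁻¹' Algebra.smoothLocus k A
  rw [Algebra.smoothLocus_comap_of_isLocalization y]
  change Algebra.FormallySmooth k (Localization.AtPrime q'.asIdeal)
  infer_instance

lemma aeval_eps (f : Polynomial ℂ) : Polynomial.aeval (DualNumber.eps : DualNumber ℂ) f =
    TrivSqZeroExt.inl (f.coeff 0) + TrivSqZeroExt.inr (f.coeff 1) := by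
  induction f using Polynomial.induction_on' with
  | add p q hp hq => rw [map_add, hp, hq]; ext <;> simp
  | monomial n a =>
    rw [Polynomial.aeval_monomial]
    match n with
    | 0 => ext <;> simp [TrivSqZeroExt.algebraMap_eq_inl]
    | 1 => ext <;> simp [TrivSqZeroExt.algebraMap_eq_inl]
    | n + 2 =>
      have : (DualNumber.eps : DualNumber ℂ) ^ (n + 2) = 0 := by
        rw [pow_add, pow_two, DualNumber.eps_mul_eps, mul_zero]
      rw [this]; ext <;> simp [Polynomial.coeff_monomial]

/-- The projection `ℂ[X]/(X³) → ℂ[ε]`. -/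
def truncateHom : Polynomial ℂ ⧸ Ideal.span {(Polynomial.X ^ 3 : Polynomial ℂ)} →ₐ[ℂ] DualNumber ℂ :=
  Ideal.Quotient.liftₐ _ (Polynomial.aeval DualNumber.eps) fun f hf => by
    obtain ⟨g, rfl⟩ := Ideal.mem_span_singleton.1 hf
    rw [map_mul, map_pow, Polynomial.aeval_X, pow_succ, pow_two, DualNumber.eps_mul_eps, zero_mul,
      zero_mul]

lemma truncateHom_mk (f : Polynomial ℂ) : truncateHom (Ideal.Quotient.mk _ f) =
    TrivSqZeroExt.inl (f.coeff 0) + TrivSqZeroExt.inr (f.coeff 1) := aeval_eps f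

lemma truncateHom_surjective : Function.Surjective truncateHom := fun z =>
  ⟨Ideal.Quotient.mk _ (Polynomial.C z.fst + Polynomial.C z.snd * Polynomial.X), by
    rw [truncateHom_mk]; ext <;> simp⟩

lemma isNilpotent_ker_truncateHom : IsNilpotent (RingHom.ker truncateHom) := by
  have h : RingHom.ker truncateHom ≤
      Ideal.span {Ideal.Quotient.mk _ (Polynomial.X ^ 2)} := by
    intro z hz
    obtain ⟨f, rfl⟩ := Ideal.Quotient.mk_surjective z
    have hz' : truncateHom (Ideal.Quotient.mk _ f) = 0 := hz
    rw [truncateHom_mk] at hz'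
    have h0 : f.coeff 0 = 0 := by simpa using congrArg TrivSqZeroExt.fst hz'
    have h1 : f.coeff 1 = 0 := by simpa using congrArg TrivSqZeroExt.snd hz'
    rw [Ideal.mem_span_singleton]
    refine map_dvd _ (Polynomial.X_pow_dvd_iff.2 fun d hd => ?_)
    interval_cases d <;> assumption
  refine ⟨2, ?_⟩
  rw [Ideal.zero_eq_bot, eq_bot_iff]
  refine (Ideal.pow_right_mono h 2).trans ?_
  rw [Ideal.span_singleton_pow, ← map_pow, Ideal.span_singleton_le_iff_mem, Ideal.mem_bot,
    Ideal.Quotient.eq_zero_iff_mem, Ideal.mem_span_singleton]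
  exact ⟨Polynomial.X, by ring⟩

/-- A tangent vector along which the relation `x y = z w` has non-zero quadratic term obstructs
smoothness. -/
lemma not_isSmoothAt_of_tangent {A : Type*} [CommRing A] [Algebra ℂ A] (p : Ideal A) [p.IsPrime]
    (D : A →ₐ[ℂ] DualNumber ℂ) (hD : ∀ a, a ∉ p → (D a).fst ≠ 0) {x y z w : A}
    (hxy : x * y = z * w) (hx : D x = DualNumber.eps) (hy : D y = DualNumber.eps) (hz : D z = 0)
    (hw : D w = 0) : ¬ Algebra.IsSmoothAt ℂ p := by
  intro hs
  have hs' : Algebra.FormallySmooth ℂ (Localization.AtPrime p) := hs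
  let D' : Localization.AtPrime p →ₐ[ℂ] DualNumber ℂ :=
    IsLocalization.liftAlgHom (M := p.primeCompl) (f := D) fun a =>
      TrivSqZeroExt.isUnit_iff_isUnit_fst.2 (isUnit_iff_ne_zero.2 (hD a a.2))
  let F := Algebra.FormallySmooth.liftOfSurjective D' truncateHom truncateHom_surjective
    isNilpotent_ker_truncateHom
  have hF (a : A) : truncateHom (F (algebraMap A _ a)) = D a := by
    rw [Algebra.FormallySmooth.liftOfSurjective_apply]
    exact IsLocalization.lift_eq _ a
  choose f hf using fun a : A => Ideal.Quotient.mk_surjective (F (algebraMap A _ a))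
  have hf' (a : A) : TrivSqZeroExt.inl ((f a).coeff 0) + TrivSqZeroExt.inr ((f a).coeff 1) = D a := by
    rw [← truncateHom_mk, hf, hF]
  have h0 (a : A) : (f a).coeff 0 = (D a).fst := by
    simpa using congrArg TrivSqZeroExt.fst (hf' a)
  have h1 (a : A) : (f a).coeff 1 = (D a).snd := by
    simpa using congrArg TrivSqZeroExt.snd (hf' a)
  have hrel : f x * f y - f z * f w ∈ Ideal.span {(Polynomial.X ^ 3 : Polynomial ℂ)} := by
    rw [← Ideal.Quotient.eq_zero_iff_mem, map_sub, map_mul, map_mul, hf, hf, hf, hf, ← map_mul,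
      ← map_mul, ← map_mul, ← map_mul, hxy, sub_self]
  have hc := Polynomial.X_pow_dvd_iff.1 (Ideal.mem_span_singleton.1 hrel) 2 (by norm_num)
  rw [Polynomial.coeff_sub, Polynomial.coeff_mul, Polynomial.coeff_mul] at hc
  simp [Finset.Nat.antidiagonal_succ, h0, h1, hx, hy, hz, hw] at hc

end SmoothLocus

section Cone

variable {V : Type*} [AddCommGroup V] [Module ℂ V]

lemma coneLinear_mul_coneLinear (b : Basis (Fin 3) ℂ V) (i j k l : Fin 3) :
    coneLinear (tensorCoord b i j) * coneLinear (tensorCoord b k l) =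
      coneLinear (tensorCoord b i l) * coneLinear (tensorCoord b k j) := by
  refine coneRing_ext_tmul b fun v w => ?_
  rw [map_mul, map_mul, coneEval_coneLinear, coneEval_coneLinear, coneEval_coneLinear,
    coneEval_coneLinear, tensorCoord_tmul, tensorCoord_tmul, tensorCoord_tmul, tensorCoord_tmul]
  ring

/-- Regular functions to first order at `0` in the direction `E`. -/
def tangentHom (E : V ⊗[ℂ] V) : Reg (V ⊗[ℂ] V) →ₐ[ℂ] DualNumber ℂ :=
  SymmetricAlgebra.lift ((LinearMap.toSpanSingleton ℂ (DualNumber ℂ) DualNumber.eps) ∘ₗ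
    Dual.eval ℂ (V ⊗[ℂ] V) E)

lemma tangentHom_ι (E : V ⊗[ℂ] V) (l : Dual ℂ (V ⊗[ℂ] V)) :
    tangentHom E (SymmetricAlgebra.ι ℂ _ l) = l E • DualNumber.eps := by
  simp [tangentHom]

lemma fst_tangentHom (E : V ⊗[ℂ] V) (p : Reg (V ⊗[ℂ] V)) :
    (tangentHom E p).fst = evalAt 0 p := by
  have : (TrivSqZeroExt.fstHom ℂ ℂ ℂ).comp (tangentHom E) = evalAt 0 := by
    apply SymmetricAlgebra.algHom_ext
    ext l
    simp [tangentHom_ι, evalAt]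
  exact DFunLike.congr_fun this p

lemma snd_tangentHom_add (E E' : V ⊗[ℂ] V) (p : Reg (V ⊗[ℂ] V)) :
    (tangentHom (E + E') p).snd = (tangentHom E p).snd + (tangentHom E' p).snd := by
  induction p using SymmetricAlgebra.induction with
  | algebraMap r => simp [AlgHom.commutes, TrivSqZeroExt.algebraMap_eq_inl]
  | mul x y hx hy =>
    simp only [map_mul, TrivSqZeroExt.snd_mul, hx, hy, fst_tangentHom]
    simp
    ring
  | add x y hx hy => simp only [map_add, TrivSqZeroExt.snd_add, hx, hy]; ring
  | ι l => simp [tangentHom_ι]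

lemma smul_mem_rankOneCone (b : Basis (Fin 3) ℂ V) (s : ℂ) {E : V ⊗[ℂ] V}
    (hE : E ∈ rankOneCone V) : s • E ∈ rankOneCone V := by
  obtain ⟨v, w, rfl⟩ := exists_eq_tmul b hE
  rw [smul_tmul']
  exact tmul_mem_rankOneCone _ _

lemma tangentHom_eq_zero (b : Basis (Fin 3) ℂ V) {E : V ⊗[ℂ] V} (hE : E ∈ rankOneCone V)
    {p : Reg (V ⊗[ℂ] V)} (hp : p ∈ idealOf (rankOneCone V)) : tangentHom E p = 0 := by
  let line : Reg (V ⊗[ℂ] V) →ₐ[ℂ] Polynomial ℂ :=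
    SymmetricAlgebra.lift ((LinearMap.toSpanSingleton ℂ (Polynomial ℂ) Polynomial.X) ∘ₗ
      Dual.eval ℂ (V ⊗[ℂ] V) E)
  have h1 : (Polynomial.aeval DualNumber.eps).comp line = tangentHom E := by
    apply SymmetricAlgebra.algHom_ext
    ext l <;> simp [line, tangentHom_ι]
  have h2 (s : ℂ) : (Polynomial.aeval s).comp line = evalAt (s • E) := by
    apply SymmetricAlgebra.algHom_ext
    ext l
    simp [line, evalAt, mul_comm]
  have h3 : line p = 0 := Polynomial.funext fun s => by
    rw [Polynomial.eval_zero, ← Polynomial.coe_aeval_eq_eval]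
    exact (DFunLike.congr_fun (h2 s) p).trans (mem_idealOf.1 hp _ (smul_mem_rankOneCone b s hE))
  rw [← h1, AlgHom.comp_apply, h3, map_zero]

/-- Every `E + E'` with `E`, `E'` in the cone is a tangent vector of the cone at `0`. -/
def coneTangent (b : Basis (Fin 3) ℂ V) {E E' : V ⊗[ℂ] V} (hE : E ∈ rankOneCone V)
    (hE' : E' ∈ rankOneCone V) : ConeRing V →ₐ[ℂ] DualNumber ℂ :=
  Ideal.Quotient.liftₐ _ (tangentHom (E + E')) fun p hp => by
    ext
    · rw [fst_tangentHom]
      exact mem_idealOf.1 hp 0 zero_mem_rankOneCone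
    · rw [snd_tangentHom_add, tangentHom_eq_zero b hE hp, tangentHom_eq_zero b hE' hp]
      simp

lemma coneTangent_coneLinear (b : Basis (Fin 3) ℂ V) {E E' : V ⊗[ℂ] V} (hE : E ∈ rankOneCone V)
    (hE' : E' ∈ rankOneCone V) (l : Dual ℂ (V ⊗[ℂ] V)) :
    coneTangent b hE hE' (coneLinear l) = l (E + E') • DualNumber.eps := tangentHom_ι _ l

lemma fst_coneTangent (b : Basis (Fin 3) ℂ V) {E E' : V ⊗[ℂ] V} (hE : E ∈ rankOneCone V)
    (hE' : E' ∈ rankOneCone V) (x : ConeRing V) :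
    (coneTangent b hE hE' x).fst = coneEval 0 zero_mem_rankOneCone x := by
  obtain ⟨p, rfl⟩ := Ideal.Quotient.mk_surjective x
  exact fst_tangentHom _ p

variable (V) in
/-- The origin of `(V ⊗ V)_1`. -/
def coneOrigin : PrimeSpectrum (ConeRing V) := conePoint 0 zero_mem_rankOneCone

lemma mem_coneOrigin (x : ConeRing V) :
    x ∈ (coneOrigin V).asIdeal ↔ coneEval 0 zero_mem_rankOneCone x = 0 := Iff.rfl

lemma coneOrigin_notMem_smoothLocus (b : Basis (Fin 3) ℂ V) :
    coneOrigin V ∉ Algebra.smoothLocus ℂ (ConeRing V) := by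
  have h (i j : Fin 3) : tensorCoord b i j (b 0 ⊗ₜ[ℂ] b 0 + b 1 ⊗ₜ[ℂ] b 1) =
      (Finsupp.single 0 1 : Fin 3 →₀ ℂ) i * (Finsupp.single 0 1 : Fin 3 →₀ ℂ) j +
      (Finsupp.single 1 1 : Fin 3 →₀ ℂ) i * (Finsupp.single 1 1 : Fin 3 →₀ ℂ) j := by
    rw [map_add, tensorCoord_tmul, tensorCoord_tmul, b.repr_self, b.repr_self]
  refine not_isSmoothAt_of_tangent (coneOrigin V).asIdeal (coneTangent b (tmul_mem_rankOneCone (b 0) (b 0))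
    (tmul_mem_rankOneCone (b 1) (b 1))) (fun a ha => ?_)
    (coneLinear_mul_coneLinear b 0 0 1 1) ?_ ?_ ?_ ?_
  · rw [fst_coneTangent]
    exact fun h => ha ((mem_coneOrigin _).2 h)
  all_goals rw [coneTangent_coneLinear, h]; simp

/-- The part of the coordinate ring generated by the `i`-th row and the `j`-th column. -/
def chartHom (b : Basis (Fin 3) ℂ V) (i j : Fin 3) :
    MvPolynomial {q : Fin 3 × Fin 3 // q.1 = i ∨ q.2 = j} ℂ →ₐ[ℂ] ConeRing V :=
  MvPolynomial.aeval fun q => coneLinear (tensorCoord b q.1.1 q.1.2)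

lemma chartHom_X (b : Basis (Fin 3) ℂ V) (i j k l : Fin 3) (h : k = i ∨ l = j) :
    chartHom b i j (MvPolynomial.X ⟨(k, l), h⟩) = coneLinear (tensorCoord b k l) := by
  simp [chartHom]

lemma chartHom_injective (b : Basis (Fin 3) ℂ V) (i j : Fin 3) :
    Function.Injective (chartHom b i j) := by
  refine (injective_iff_map_eq_zero _).2 fun p hp => ?_
  let q₀ : {q : Fin 3 × Fin 3 // q.1 = i ∨ q.2 = j} := ⟨(i, j), .inl rfl⟩
  refine (mul_eq_zero.1 (MvPolynomial.funext fun c => ?_ : MvPolynomial.X q₀ * p = 0)).resolve_left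
    (MvPolynomial.X_ne_zero q₀)
  rw [map_mul, MvPolynomial.eval_X, map_zero]
  by_cases hc : c q₀ = 0
  · rw [hc, zero_mul]
  let v := b.equivFun.symm fun k => c ⟨(k, j), .inr rfl⟩
  let w := b.equivFun.symm fun l => c ⟨(i, l), .inl rfl⟩ / c q₀
  have hv (k : Fin 3) : b.repr v k = c ⟨(k, j), .inr rfl⟩ :=
    congrFun (b.equivFun.apply_symm_apply _) k
  have hw (l : Fin 3) : b.repr w l = c ⟨(i, l), .inl rfl⟩ / c q₀ :=
    congrFun (b.equivFun.apply_symm_apply _) l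
  have h1 : (coneEval _ (tmul_mem_rankOneCone v w)).comp (chartHom b i j) =
      MvPolynomial.aeval c := by
    apply MvPolynomial.algHom_ext
    rintro ⟨⟨k, l⟩, hkl⟩
    rw [AlgHom.comp_apply, chartHom_X, coneEval_coneLinear, tensorCoord_tmul, hv, hw,
      MvPolynomial.aeval_X]
    rcases hkl with h | h
    · obtain rfl : k = i := h
      exact mul_div_cancel₀ _ hc
    · obtain rfl : l = j := h
      change _ * (c q₀ / c q₀) = _
      rw [div_self hc, mul_one]
  have h2 := DFunLike.congr_fun h1 p
  rw [AlgHom.comp_apply, hp, map_zero] at h2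
  rw [← MvPolynomial.coe_aeval_eq_eval]
  exact mul_eq_zero_of_right _ h2.symm

lemma exists_pow_mul_eq_chartHom (b : Basis (Fin 3) ℂ V) (i j : Fin 3) (x : ConeRing V) :
    ∃ (n : ℕ) (p : _), coneLinear (tensorCoord b i j) ^ n * x = chartHom b i j p := by
  have hx : x ∈ Algebra.adjoin ℂ {x : ConeRing V | ∃ i j, x = coneLinear (tensorCoord b i j)} := by
    rw [adjoin_range_coneLinear]; trivial
  have h0 := chartHom_X b i j i j (.inl rfl)
  induction hx using Algebra.adjoin_induction with
  | mem x hx =>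
    obtain ⟨k, l, rfl⟩ := hx
    refine ⟨1, MvPolynomial.X ⟨(i, l), .inl rfl⟩ * MvPolynomial.X ⟨(k, j), .inr rfl⟩, ?_⟩
    rw [pow_one, map_mul, chartHom_X, chartHom_X, coneLinear_mul_coneLinear]
  | algebraMap r => exact ⟨0, MvPolynomial.C r, by simp [chartHom]⟩
  | add x y _ _ hx hy =>
    obtain ⟨n, p, hp⟩ := hx
    obtain ⟨m, q, hq⟩ := hy
    refine ⟨n + m, MvPolynomial.X ⟨(i, j), .inl rfl⟩ ^ m * p +
      MvPolynomial.X ⟨(i, j), .inl rfl⟩ ^ n * q, ?_⟩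
    rw [map_add, map_mul, map_mul, ← hp, ← hq, map_pow, map_pow, h0]
    ring
  | mul x y _ _ hx hy =>
    obtain ⟨n, p, hp⟩ := hx
    obtain ⟨m, q, hq⟩ := hy
    refine ⟨n + m, p * q, ?_⟩
    rw [map_mul, ← hp, ← hq]
    ring

lemma mem_smoothLocus_of_coord (b : Basis (Fin 3) ℂ V) (i j : Fin 3)
    (q : PrimeSpectrum (ConeRing V)) (hq : coneLinear (tensorCoord b i j) ∉ q.asIdeal) :
    q ∈ Algebra.smoothLocus ℂ (ConeRing V) := by
  have h0 := chartHom_X b i j i j (.inl rfl)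
  refine mem_smoothLocus_of_subalgebra (chartHom b i j) (chartHom_injective b i j)
    (MvPolynomial.X ⟨(i, j), .inl rfl⟩) (fun a => ?_) q ?_
  · rw [h0]
    exact exists_pow_mul_eq_chartHom b i j a
  · rwa [h0]

lemma eq_coneOrigin (b : Basis (Fin 3) ℂ V) (q : PrimeSpectrum (ConeRing V))
    (hq : ∀ i j, coneLinear (tensorCoord b i j) ∈ q.asIdeal) :
    q = coneOrigin V := by
  have h (x : ConeRing V) :
      x - algebraMap ℂ _ (coneEval 0 zero_mem_rankOneCone x) ∈ q.asIdeal := by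
    have hx : x ∈ Algebra.adjoin ℂ {x : ConeRing V | ∃ i j, x = coneLinear (tensorCoord b i j)} := by
      rw [adjoin_range_coneLinear]; trivial
    induction hx using Algebra.adjoin_induction with
    | mem x hx =>
      obtain ⟨k, l, rfl⟩ := hx
      rw [coneEval_coneLinear, map_zero, map_zero, sub_zero]
      exact hq k l
    | algebraMap r => simp
    | add x y _ _ hx hy =>
      rw [map_add, map_add, add_sub_add_comm]
      exact add_mem hx hy
    | mul x y _ _ hx hy =>
      rw [map_mul, map_mul]
      convert add_mem (q.asIdeal.mul_mem_right y hx) (q.asIdeal.mul_mem_left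
        (algebraMap ℂ _ (coneEval 0 zero_mem_rankOneCone x)) hy) using 1
      ring
  ext x
  rw [mem_coneOrigin]
  constructor
  · intro hx
    by_contra h0
    refine q.2.ne_top (q.asIdeal.eq_top_of_isUnit_mem (x := algebraMap ℂ _ (coneEval 0
      zero_mem_rankOneCone x)) ?_ ((isUnit_iff_ne_zero.2 h0).map _))
    simpa using sub_mem hx (h x)
  · intro hx
    simpa [hx] using h x

/-- The singular locus of `(V ⊗ V)_1` is the origin. -/
lemma compl_smoothLocus_cone (b : Basis (Fin 3) ℂ V) :
    (Algebra.smoothLocus ℂ (ConeRing V))ᶜ = {coneOrigin V} := by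
  ext q
  rw [Set.mem_compl_iff, Set.mem_singleton_iff]
  constructor
  · intro hq
    refine eq_coneOrigin b q fun i j => ?_
    by_contra hij
    exact hq (mem_smoothLocus_of_coord b i j q hij)
  · rintro rfl
    exact coneOrigin_notMem_smoothLocus b

end Cone
end

noncomputable section

section Main

variable {V : Type*} [AddCommGroup V] [Module ℂ V] [FiniteDimensional ℂ V]

lemma comap_sigmaRingHom_coneOrigin (b : Basis (Fin 3) ℂ V) :
    PrimeSpectrum.comap (sigmaRingHom b) (coneOrigin V) = yPoint b 0 zero_mem_degenerate := by
  refine PrimeSpectrum.ext (Ideal.ext fun r => ?_)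
  obtain ⟨p, rfl⟩ := Ideal.Quotient.mk_surjective r
  change coneEval 0 zero_mem_rankOneCone (sigmaRingHom b (Ideal.Quotient.mk _ p)) = 0 ↔
    evalAt 0 p = 0
  rw [coneEval_sigmaRingHom, map_zero]

lemma eq_coneOrigin_of_comap_sigmaRingHom (b : Basis (Fin 3) ℂ V)
    (q : PrimeSpectrum (ConeRing V))
    (hq : PrimeSpectrum.comap (sigmaRingHom b) q = yPoint b 0 zero_mem_degenerate) :
    q = coneOrigin V := by
  have hker (p : RegSym V) (hp : evalAt (0 : Sym2Tensor V) p = 0) :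
      sigmaRingHom b (Ideal.Quotient.mk _ p) ∈ q.asIdeal := by
    change Ideal.Quotient.mk _ p ∈ (PrimeSpectrum.comap (sigmaRingHom b) q).asIdeal
    rw [hq]
    exact hp
  have hmat (i j : Fin 3) : evalAt (0 : Sym2Tensor V) ((universalPresentation b).mat i j) = 0 := by
    rw [evalAt_mat, ZeroMemClass.coe_zero, map_zero]
  have hxi (k : Fin 3) : xiImage b k ∈ q.asIdeal := by
    refine (q.2.mem_or_mem (x := xiImage b k) (y := xiImage b k) ?_).elim id id
    rw [xiImage_mul_xiImage]
    apply hker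
    rw [Matrix.adjugate_fin_three]
    fin_cases k <;> simp [hmat]
  refine eq_coneOrigin b q fun i j => ?_
  obtain ⟨c, hc⟩ := exists_coneLinear_eq b i j
  have hsmul (a : ℂ) {x : ConeRing V} (hx : x ∈ q.asIdeal) : a • x ∈ q.asIdeal :=
    Submodule.smul_of_tower_mem q.asIdeal a hx
  rw [hc]
  exact add_mem (hsmul _ (hker _ (hmat i j))) (sum_mem fun k _ => hsmul _ (hxi k))

/-- The isomorphism `τ : (V ⊗ V)_1 ≅ X(V)`. -/
def tauIso (b : Basis (Fin 3) ℂ V) : ConeScheme V ≅ XScheme b :=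
  Scheme.Spec.mapIso (tauEquiv b).toRingEquiv.toCommRingCatIso.op

lemma tauIso_hom (b : Basis (Fin 3) ℂ V) : (tauIso b).hom =
    Spec.map (CommRingCat.ofHom ((tauEquiv b : XRing b ≃ₐ[ℂ] ConeRing V) : XRing b →+* ConeRing V)) :=
  rfl

lemma tauIso_hom_coverMap (b : Basis (Fin 3) ℂ V) :
    (tauIso b).hom ≫ coverMap b = sigmaMap b := by
  rw [tauIso_hom, coverMap, sigmaMap, ← Spec.map_comp, ← CommRingCat.ofHom_comp]
  congr 2
  exact RingHom.ext (tauHom_structureHom b)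

lemma tauIso_hom_coverInvolution (b : Basis (Fin 3) ℂ V) :
    (tauIso b).hom ≫ coverInvolution b = coneTranspose V ≫ (tauIso b).hom := by
  rw [tauIso_hom, coverInvolution, coneTranspose, ← Spec.map_comp, ← Spec.map_comp,
    ← CommRingCat.ofHom_comp, ← CommRingCat.ofHom_comp]
  congr 2
  exact RingHom.ext fun x => (coneTranspose_tauHom b x).symm

lemma tauIso_hom_bijective (b : Basis (Fin 3) ℂ V) : Function.Bijective (tauIso b).hom :=
  ((tauIso b).hom.homeomorph).bijective

/-- An isomorphism preserves the smooth locus. -/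
lemma comap_mem_smoothLocus_iff {k A B : Type*} [CommRing k] [CommRing A] [CommRing B]
    [Algebra k A] [Algebra k B] (e : A ≃ₐ[k] B) (q : PrimeSpectrum B) :
    PrimeSpectrum.comap (e : A →+* B) q ∈ Algebra.smoothLocus k A ↔
      q ∈ Algebra.smoothLocus k B := by
  let : Algebra A B := (e : A →+* B).toAlgebra
  have : IsScalarTower k A B := .of_algHom (e : A →ₐ[k] B)
  have : IsLocalization.Away (1 : A) B :=
    IsLocalization.away_of_isUnit_of_bijective B isUnit_one e.bijective
  exact Set.ext_iff.1 (Algebra.smoothLocus_comap_of_isLocalization (R := k) (Af := B) (1 : A)) q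

lemma singularLocus_eq (b : Basis (Fin 3) ℂ V) :
    singularLocus b = {(tauIso b).hom (conePoint 0 zero_mem_rankOneCone)} := by
  ext x
  obtain ⟨q, rfl⟩ := (tauIso_hom_bijective b).2 x
  have h1 : (tauIso b).hom q ∈ singularLocus b ↔ q ∈ (Algebra.smoothLocus ℂ (ConeRing V))ᶜ :=
    not_congr (comap_mem_smoothLocus_iff (tauEquiv b) q)
  rw [compl_smoothLocus_cone b] at h1
  exact h1.trans (tauIso_hom_bijective b).1.eq_iff.symm

lemma coverMap_preimage (b : Basis (Fin 3) ℂ V) :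
    coverMap b ⁻¹' {yPoint b 0 zero_mem_degenerate} =
      {(tauIso b).hom (conePoint 0 zero_mem_rankOneCone)} := by
  have h (q : ConeScheme V) : coverMap b ((tauIso b).hom q) =
      PrimeSpectrum.comap (sigmaRingHom b) q := by
    rw [← Scheme.Hom.comp_apply, tauIso_hom_coverMap]
    rfl
  ext x
  obtain ⟨q, rfl⟩ := (tauIso_hom_bijective b).2 x
  constructor
  · intro hx
    exact congrArg (tauIso b).hom (eq_coneOrigin_of_comap_sigmaRingHom b q ((h q).symm.trans hx))
  · intro hx
    obtain rfl : q = coneOrigin V := (tauIso_hom_bijective b).1 hx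
    exact (h _).trans (comap_sigmaRingHom_coneOrigin b)

end Main
end

theorem mainTheorem11 {V : Type*} [AddCommGroup V] [Module ℂ V] [FiniteDimensional ℂ V]
    (b : Module.Basis (Fin 3) ℂ V) :
    idealOf (degenerate V) = (universalPresentation b).fitt ∧
    ∃ τ : ConeScheme V ≅ XScheme b,
      τ.hom ≫ coverMap b = sigmaMap b ∧
      τ.hom ≫ coverInvolution b = coneTranspose V ≫ τ.hom ∧
      (∃ e : XRing b ≃ₐ[ℂ] ConeRing V,
        τ.hom = Spec.map (CommRingCat.ofHom (e : XRing b →+* ConeRing V)) ∧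
        ∀ k : Fin 3, e (xiCoord b k) = Complex.I • coneLinear (skewCoord b k)) ∧
      singularLocus b = {τ.hom (conePoint 0 zero_mem_rankOneCone)} ∧
      coverMap b ⁻¹' {yPoint b 0 zero_mem_degenerate} =
        {τ.hom (conePoint 0 zero_mem_rankOneCone)} :=
  ⟨idealOf_degenerate b, tauIso b, tauIso_hom_coverMap b, tauIso_hom_coverInvolution b,
    ⟨tauEquiv b, tauIso_hom b, tauHom_xiCoord b⟩, singularLocus_eq b, coverMap_preimage b⟩
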